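/- For $m\ge 2$ let $\mathcal S_m$ be the set of density matrices, i.e. positive semidefinite Hermitian matrices $S\in\mathbb C^{m\times m}$ with $\operatorname{tr}S=1$, and let $\mathcal S_{r,m}=\{S\in\mathcal S_m:\operatorname{rank}S\le r\}$. Let $E_1,\dots,E_{m^2}$ be a basis of the real space of Hermitian $m\times m$ matrices that is orthonormal for $\langle A,B\rangle=\operatorname{tr}(AB)$. For $\rho\in\mathcal S_m$ and $\sigma_\xi>0$ let $\mathbb P_\rho$ be the law of $n$ i.i.d. copies $(X_1,Y_1),\dots,(X_n,Y_n)$ of $(X,Y)$, where $X$ is uniformly distributed on $\{E_1,\dots,E_{m^2}\}$ and $Y=\langle\rho,X\rangle+\xi$ with $\xi\sim N(0,\sigma_\xi^2)$ independent of $X$. For Hermitian $A$ with eigenvalues $\lambda_1,\dots,\lambda_m$ let $\|A\|_q=(\sum_j|\lambda_j|^q)^{1/q}$ for $1\le q<\infty$ and $\|A\|_\infty=\max_j|\lambda_j|$ (Schatten norms). For $S_1,S_2\in\mathcal S_m$ let $$H^2(S_1,S_2)=2-2\operatorname{tr}\sqrt{S_1^{1/2}S_2S_1^{1/2}}$$ be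 the squared Bures distance and $K(S_1\|S_2)=\langle S_1,\log S_1-\log S_2\rangle$ the quantum relative entropy (with $0\log 0=0$ in $\operatorname{tr}(S_1\log S_1)$), set equal to $+\infty$ if $S_2$ has a zero eigenvalue. **Theorem.** For every $q\in[1,\infty]$ there are constants $c,c'>0$ (depending on nothing but $q$) such that for all integers $m\ge2$, $n\ge1$, $1\le r\le m$, all $\sigma_\xi>0$ and every orthonormal basis as above, $$\inf_{\hat\rho}\ \sup_{\rho\in\mathcal S_{r,m}}\mathbb P_\rho\Bigl\{\|\hat\rho-\rho\|_q\ge c\Bigl(\frac{\sigma_\xi m^{3/2}r^{1/q}}{\sqrt n}\wedge\Bigl(\frac{\sigma_\xi m^{3/2}}{\sqrt n}\Bigr)^{1-1/q}\wedge1\Bigr)\Bigr\}\ge c',$$ and, if moreover $r\ge2$, $$\inf_{\hat\rho}\ \sup_{\rho\in\mathcal S_{r,m}}\mathbb P_\rho\Bigl\{H^2(\hat\rho,\rho)\ge c\Bigl(\frac{\sigma_\xi m^{3/2}r}{\sqrt n}\wedge1\Bigr)\Bigr\}\ge c',$$ $$\inf_{\hat\rho}\ \sup_{\rho\in\mathcal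 S_{r,m}}\mathbb P_\rho\Bigl\{K(\rho\|\hat\rho)\ge c\Bigl(\frac{\sigma_\xi m^{3/2}r}{\sqrt n}\wedge1\Bigr)\Bigr\}\ge c',$$ where each infimum is over all estimators $\hat\rho$, i.e. measurable functions of $(X_1,Y_1),\dots,(X_n,Y_n)$ with values in $\mathcal S_m$ (they may depend on $m,n,r,\sigma_\xi$ and the basis). Here $1/q=0$ for $q=\infty$. -/

import Mathlib

open MeasureTheory ProbabilityTheory
open scoped ENNReal NNReal Matrix ComplexOrder

noncomputable section

namespace TraceRegression

/-- The entrywise (equivalently, Borel) σ-algebra on complex `m × m` matrices. -/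
instance matrixMeasurableSpace (m : ℕ) : MeasurableSpace (Matrix (Fin m) (Fin m) ℂ) :=
  inferInstanceAs (MeasurableSpace (Fin m → Fin m → ℂ))

/-- Density matrices: positive semidefinite Hermitian `m × m` matrices of unit trace. -/
abbrev DensityMatrix (m : ℕ) : Type :=
  {S : Matrix (Fin m) (Fin m) ℂ // S.PosSemidef ∧ S.trace = 1}

/-- The density matrices of rank at most `r`. -/
def lowRank (r m : ℕ) : Set (DensityMatrix m) := {S | S.1.rank ≤ r}

/-- The Hilbert–Schmidt inner product `tr (A B)` of Hermitian matrices (a real number). -/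
def hsInner {m : ℕ} (A B : Matrix (Fin m) (Fin m) ℂ) : ℝ := (A * B).trace.re

/-- `E` lists an orthonormal basis of the real inner product space of Hermitian matrices. -/
structure IsOrthonormalBasis {m : ℕ} (E : Fin (m ^ 2) → Matrix (Fin m) (Fin m) ℂ) : Prop where
  isHermitian : ∀ i, (E i).IsHermitian
  orthonormal : ∀ i j, hsInner (E i) (E j) = if i = j then 1 else 0
  span : ∀ A : Matrix (Fin m) (Fin m) ℂ, A.IsHermitian → A ∈ Submodule.span ℝ (Set.range E)

/-- The Schatten `q`-norm of a Hermitian matrix, `q ∈ [1, ∞]`: the `ℓ_q` norm of its eigenvalues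
(counted with multiplicity). -/
def schattenNorm {m : ℕ} (q : ℝ≥0∞) {A : Matrix (Fin m) (Fin m) ℂ} (hA : A.IsHermitian) : ℝ :=
  if q = ⊤ then ⨆ i, |hA.eigenvalues i|
  else (∑ i, |hA.eigenvalues i| ^ q.toReal) ^ (1 / q.toReal)

/-- The Schatten `q`-norm distance between two density matrices. -/
def schattenDist {m : ℕ} (q : ℝ≥0∞) (S₁ S₂ : DensityMatrix m) : ℝ :=
  schattenNorm q (S₁.2.1.isHermitian.sub S₂.2.1.isHermitian)

/-- The squared Bures (quantum Hellinger) distance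
`2 - 2 tr √(S₁^{1/2} S₂ S₁^{1/2})`, square roots being taken by functional calculus. -/
def buresSq {m : ℕ} (S₁ S₂ : DensityMatrix m) : ℝ :=
  2 - 2 * (cfc Real.sqrt (cfc Real.sqrt S₁.1 * S₂.1 * cfc Real.sqrt S₁.1)).trace.re

open Classical in
/-- Quantum relative entropy `K(S₁‖S₂) = ⟨S₁, log S₁ - log S₂⟩`, equal to `+∞` if `S₂` has
a zero eigenvalue. As `Real.log 0 = 0`, the term `tr (S₁ log S₁)` follows the convention
`0 log 0 = 0`. -/
def relEntropy {m : ℕ} (S₁ S₂ : DensityMatrix m) : EReal :=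
  if S₂.1.PosDef then
    ((hsInner S₁.1 (cfc Real.log S₁.1 - cfc Real.log S₂.1) : ℝ) : EReal)
  else ⊤

/-- The law of one observation `(X, Y)`: `X` is uniform in the basis `E` and
`Y = ⟨ρ, X⟩ + ξ` with `ξ ∼ N(0, σ²)` independent of `X`. -/
def obsLaw {m : ℕ} (E : Fin (m ^ 2) → Matrix (Fin m) (Fin m) ℂ) (σ : ℝ≥0)
    (ρ : DensityMatrix m) : Measure (Matrix (Fin m) (Fin m) ℂ × ℝ) :=
  ((uniformOn (Set.univ : Set (Fin (m ^ 2)))).prod (gaussianReal 0 (σ ^ 2))).map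
    fun p => (E p.1, hsInner ρ.1 (E p.1) + p.2)

/-- The law `ℙ_ρ` of the sample `(X₁, Y₁), …, (Xₙ, Yₙ)` of i.i.d. observations. -/
def sampleLaw {m : ℕ} (n : ℕ) (E : Fin (m ^ 2) → Matrix (Fin m) (Fin m) ℂ) (σ : ℝ≥0)
    (ρ : DensityMatrix m) : Measure (Fin n → Matrix (Fin m) (Fin m) ℂ × ℝ) :=
  Measure.pi fun _ => obsLaw E σ ρ

/-- Estimators with values in the density matrices: measurable functions of the data. -/
abbrev Estimator (m n : ℕ) : Type :=
  {f : (Fin n → Matrix (Fin m) (Fin m) ℂ × ℝ) → DensityMatrix m // Measurable f}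

/-- `inf_{ρ̂} sup_{ρ ∈ S_{r,m}} ℙ_ρ {bad ρ̂ ρ}`, the infimum over all estimators `ρ̂`. -/
def minimaxProb {m : ℕ} (n r : ℕ) (E : Fin (m ^ 2) → Matrix (Fin m) (Fin m) ℂ) (σ : ℝ≥0)
    (bad : DensityMatrix m → DensityMatrix m → Prop) : ℝ≥0∞ :=
  ⨅ est : Estimator m n, ⨆ ρ ∈ lowRank r m, sampleLaw n E σ ρ {d | bad (est.1 d) ρ}

/-- The noise level `τ = σ m^{3/2} / √n`. -/
def noiseLevel (m n : ℕ) (σ : ℝ≥0) : ℝ := σ * (m : ℝ) ^ (3 / 2 : ℝ) / √(n : ℝ)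

end TraceRegression

end

open TraceRegression

/-!
The lower bounds come from Assouad's cube method, run with probabilities in place of expectations.

**The cube.** For a frame of isometries `P : ℂˡ → ℂᵐ`, `V : ℂᵃ → ℂᵐ` with orthogonal ranges and a
sign matrix `Y ∈ {±1}^{a × l}`, put `B = P + (s / √a) V Y`. The state `Frame.state` is a base pure
state of mass `β` plus a fixed multiple of `B Bᴴ`. It has rank at most `l + 1` (at most `l` if
`β = 0`), its trace does not depend on `Y`, and to first order `Y` is the off-diagonal block of the
matrix. Let `τ` be the noise level, cut off at one. The number `l` of directions is comparable to
`min (r, 1 / τ)` and their mass is of order `τ` each; for `r = 1` there is one direction of full mass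
and the relative perturbation `s` is of order `τ` instead. Flipping one sign moves the state by
`O(τ / √m)` in Hilbert–Schmidt norm. By Bessel's inequality and the Hellinger affinity of Gaussian
shifts this cannot be detected from the sample (`errors_ge_of_close`).

**Decoding.** By `assouad_prob`, no decoder can, for every pattern and with probability close to one,
keep the share of wrong signs below a certain constant. So a loss is bounded below as soon as two sign
patterns, both within small loss of the same estimate, must agree in most places. Only typical
patterns need this property: those with `‖Y‖₄⁴ = O(l a²)`, which by a second moment computation are
most of the cube. If two of them differ in a fixed share of their entries, then
`‖M‖₂³ ≤ ‖M‖₁ ‖M‖₄²` gives `‖Y - Y'‖₁ ≳ l √a`, and the polar factor `U` of `Y - Y'` yields the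
observable `W = V U Pᴴ + P Uᴴ Vᴴ` with `tr (W (ρ - ρ')) ≳ τ l`.

**The losses.** `W` has norm at most `2` and rank at most `2 l`, so Hölder's inequality
(`norm_trace_test_mul_le`) turns the gap into a Schatten `q`-distance of order `τ l^{1/q}`, for all
`q` at once. The Bures distance and the relative entropy are both reduced to Hellinger closeness
`IsNear`: the Bures distance through the polar decomposition, the relative entropy through
`K(ρ‖S) ≥ 2 - 2 tr (√ρ √S)`, which is a classical inequality for the joint spectral distribution of
`ρ` and `S`. If `W` annihilates the base state, `ρ` and `ρ'` have mass of order `τ l` under `W`, and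
two states near the same `S` within `h` differ under `W` by at most `O(h + √(h τ l))`
(`trace_test_le_of_isNear`). Hence `h ≳ τ l`. For qubits there is no room for a base vector orthogonal
to the frame, and two diagonal states take the place of the cube.
-/

noncomputable section

namespace TraceRegression

/-! ### Hellinger affinity -/

theorem lintegral_pi_prod {Ω : Type*} [MeasurableSpace Ω] (μ : Measure Ω) [SigmaFinite μ] :
    ∀ (n : ℕ) (f : Fin n → Ω → ℝ≥0∞), (∀ i, Measurable (f i)) →
      ∫⁻ x, ∏ i, f i (x i) ∂(Measure.pi fun _ : Fin n => μ) = ∏ i, ∫⁻ y, f i y ∂μ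
  | 0, f, _ => by simp
  | n + 1, f, hf => by
    have h := (measurePreserving_piFinSuccAbove (fun _ : Fin (n + 1) => μ) 0).symm
    rw [← h.lintegral_comp_emb (MeasurableEquiv.measurableEmbedding _)]
    simp only [Fin.prod_univ_succ, MeasurableEquiv.piFinSuccAbove_symm_apply,
      Fin.insertNthEquiv_apply]
    simp only [Fin.insertNth_zero', Fin.cons_zero, Fin.cons_succ]
    rw [lintegral_prod_mul (hf 0).aemeasurable
      (g := fun y : Fin n → Ω => ∏ i, f i.succ (y i)) ?_, lintegral_pi_prod μ n _ fun i => hf _]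
    exact (Finset.measurable_prod _ fun i _ => (hf _).comp (measurable_pi_apply i)).aemeasurable

theorem pi_withDensity {Ω : Type*} [MeasurableSpace Ω] (μ : Measure Ω) [SigmaFinite μ]
    (n : ℕ) {f : Ω → ℝ≥0∞} (hf : Measurable f) [SigmaFinite (μ.withDensity f)] :
    (Measure.pi fun _ : Fin n => μ.withDensity f) =
      (Measure.pi fun _ : Fin n => μ).withDensity fun x => ∏ i, f (x i) := by
  refine Measure.pi_eq fun s hs => ?_
  rw [withDensity_apply _ (MeasurableSet.univ_pi hs), ← lintegral_indicator
    (MeasurableSet.univ_pi hs)]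
  have : ∀ x : Fin n → Ω, (Set.univ.pi s).indicator (fun x => ∏ i, f (x i)) x =
      ∏ i, (s i).indicator f (x i) := by
    intro x
    by_cases hx : x ∈ Set.univ.pi s
    · rw [Set.indicator_of_mem hx]
      exact Finset.prod_congr rfl fun i _ => (Set.indicator_of_mem (hx i trivial) _).symm
    · rw [Set.indicator_of_notMem hx]
      simp only [Set.mem_pi, Set.mem_univ, true_imp_iff, not_forall] at hx
      obtain ⟨i, hi⟩ := hx
      exact (Finset.prod_eq_zero (Finset.mem_univ i) (Set.indicator_of_notMem hi _)).symm
  simp_rw [this]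
  rw [lintegral_pi_prod μ n (fun i => (s i).indicator f) fun i => hf.indicator (hs i)]
  exact Finset.prod_congr rfl fun i _ => by
    rw [lintegral_indicator (hs i), withDensity_apply _ (hs i)]

/-- Cauchy–Schwarz on one half of a partition. -/
theorem setLIntegral_sqrt_mul_le {Ω : Type*} [MeasurableSpace Ω] (μ : Measure Ω)
    {f g : Ω → ℝ≥0∞} (hf : Measurable f) (hg : Measurable g) {A : Set Ω} (hA : MeasurableSet A) :
    ∫⁻ x in A, (f x * g x) ^ (1 / 2 : ℝ) ∂μ ≤
      (μ.withDensity f A) ^ (1 / 2 : ℝ) * (μ.withDensity g A) ^ (1 / 2 : ℝ) := by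
  rw [withDensity_apply _ hA, withDensity_apply _ hA]
  have h := ENNReal.lintegral_mul_le_Lp_mul_Lq (μ.restrict A) (p := 2) (q := 2)
    Real.HolderConjugate.two_two (f := fun x => f x ^ (1 / 2 : ℝ))
    (g := fun x => g x ^ (1 / 2 : ℝ)) (hf.pow_const _).aemeasurable (hg.pow_const _).aemeasurable
  simp only [Pi.mul_apply, ← ENNReal.rpow_mul] at h
  norm_num at h
  simpa [ENNReal.mul_rpow_of_nonneg] using h

/-- Le Cam's bound: two laws of Hellinger affinity at least `b` cannot be told apart by a test
whose two error probabilities add up to less than `b ^ 2 / 2`. -/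
theorem sq_affinity_le_errors {Ω : Type*} [MeasurableSpace Ω] (μ : Measure Ω)
    {f g : Ω → ℝ≥0∞} (hf : Measurable f) (hg : Measurable g)
    [IsProbabilityMeasure (μ.withDensity f)] [IsProbabilityMeasure (μ.withDensity g)]
    {b : ℝ} (hb : 0 ≤ b)
    (h : ENNReal.ofReal b ≤ ∫⁻ x, (f x * g x) ^ (1 / 2 : ℝ) ∂μ) {A : Set Ω}
    (hA : MeasurableSet A) :
    b ^ 2 / 2 ≤ (μ.withDensity f).real A + (μ.withDensity g).real Aᶜ := by
  rw [← lintegral_add_compl _ hA] at h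
  have h1 := setLIntegral_sqrt_mul_le μ hf hg hA
  have h2 := setLIntegral_sqrt_mul_le μ hf hg hA.compl
  set x := (μ.withDensity f) A with hx
  set y := (μ.withDensity g) Aᶜ with hy
  have h1' : ∫⁻ x in A, (f x * g x) ^ (1 / 2 : ℝ) ∂μ ≤ x ^ (1 / 2 : ℝ) :=
    h1.trans (mul_le_of_le_one_right' (ENNReal.rpow_le_one prob_le_one (by norm_num)))
  have h2' : ∫⁻ x in Aᶜ, (f x * g x) ^ (1 / 2 : ℝ) ∂μ ≤ y ^ (1 / 2 : ℝ) :=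
    h2.trans (mul_le_of_le_one_left' (ENNReal.rpow_le_one prob_le_one (by norm_num)))
  have h3 := h.trans (add_le_add h1' h2')
  have hxt : x ≠ ⊤ := measure_ne_top _ _
  have hyt : y ≠ ⊤ := measure_ne_top _ _
  have h4 : b ≤ √x.toReal + √y.toReal := by
    have := ENNReal.toReal_mono (by finiteness) h3
    rw [ENNReal.toReal_ofReal hb, ENNReal.toReal_add (by finiteness) (by finiteness),
      ← ENNReal.toReal_rpow, ← ENNReal.toReal_rpow, ← Real.sqrt_eq_rpow, ← Real.sqrt_eq_rpow]
      at this
    exact this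
  change b ^ 2 / 2 ≤ x.toReal + y.toReal
  have h5 := Real.sq_sqrt (ENNReal.toReal_nonneg (a := x))
  have h6 := Real.sq_sqrt (ENNReal.toReal_nonneg (a := y))
  nlinarith [sq_nonneg (√x.toReal - √y.toReal), Real.sqrt_nonneg x.toReal,
    Real.sqrt_nonneg y.toReal]

theorem gaussianPDFReal_mul_eq (a b : ℝ) (v : ℝ≥0) (y : ℝ) :
    gaussianPDFReal a v y * gaussianPDFReal b v y =
      (Real.exp (-(a - b) ^ 2 / (8 * v)) * gaussianPDFReal ((a + b) / 2) v y) ^ 2 := by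
  by_cases hv : (v : ℝ) = 0
  · simp [gaussianPDFReal, hv]
  simp only [gaussianPDFReal]
  have : Real.exp (-(y - a) ^ 2 / (2 * v)) * Real.exp (-(y - b) ^ 2 / (2 * v)) =
      Real.exp (-(a - b) ^ 2 / (8 * v)) ^ 2 * Real.exp (-(y - (a + b) / 2) ^ 2 / (2 * v)) ^ 2 := by
    rw [← Real.exp_add, ← Real.exp_nat_mul, ← Real.exp_nat_mul, ← Real.exp_add]
    congr 1
    field_simp
    push_cast
    ring
  rw [mul_pow, mul_pow]
  linear_combination ((√(2 * Real.pi * v))⁻¹) ^ 2 * this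

theorem lintegral_sqrt_gaussianPDF (a b : ℝ) {v : ℝ≥0} (hv : v ≠ 0) :
    ∫⁻ y, (gaussianPDF a v y * gaussianPDF b v y) ^ (1 / 2 : ℝ) =
      ENNReal.ofReal (Real.exp (-(a - b) ^ 2 / (8 * v))) := by
  have : ∀ y, (gaussianPDF a v y * gaussianPDF b v y) ^ (1 / 2 : ℝ) =
      ENNReal.ofReal (Real.exp (-(a - b) ^ 2 / (8 * v))) * gaussianPDF ((a + b) / 2) v y := by
    intro y
    rw [gaussianPDF, gaussianPDF, gaussianPDF,
      ← ENNReal.ofReal_mul (gaussianPDFReal_nonneg _ _ _), gaussianPDFReal_mul_eq,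
      ENNReal.ofReal_rpow_of_nonneg (by positivity) (by norm_num), ← Real.sqrt_eq_rpow,
      Real.sqrt_sq (mul_nonneg (Real.exp_nonneg _) (gaussianPDFReal_nonneg _ _ _)),
      ENNReal.ofReal_mul (Real.exp_nonneg _)]
  simp_rw [this]
  rw [lintegral_const_mul _ (measurable_gaussianPDF _ _), lintegral_gaussianPDF_eq_one _ hv,
    mul_one]

/-! ### The sampling model -/

/-- The law of `(i, Y)` with `i` uniform on `Fin M` and `Y ∼ N(a i, v)` given `i`: one observation
in the coordinates of the basis. -/
def coordLaw {M : ℕ} (v : ℝ≥0) (a : Fin M → ℝ) : Measure (Fin M × ℝ) :=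
  ((uniformOn (Set.univ : Set (Fin M))).prod volume).withDensity
    fun p => gaussianPDF (a p.1) v p.2

theorem measurable_coordDensity {M : ℕ} (v : ℝ≥0) (a : Fin M → ℝ) :
    Measurable fun p : Fin M × ℝ => gaussianPDF (a p.1) v p.2 :=
  measurable_from_prod_countable_right fun i => measurable_gaussianPDF (a i) v

theorem measurable_design {m M : ℕ} (E : Fin M → Matrix (Fin m) (Fin m) ℂ) :
    Measurable fun p : Fin M × ℝ => (E p.1, p.2) :=
  measurable_from_prod_countable_right fun i =>
    (measurable_prodMk_left : Measurable fun y : ℝ => (E i, y))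

theorem measurable_shift {M : ℕ} (a : Fin M → ℝ) :
    Measurable fun p : Fin M × ℝ => (p.1, a p.1 + p.2) :=
  measurable_from_prod_countable_right fun i =>
    (by fun_prop : Measurable fun y : ℝ => (i, a i + y))

/-- `coordLaw` is the law of the regression model with Gaussian noise. -/
theorem coordLaw_eq_map {M : ℕ} {v : ℝ≥0} (hv : v ≠ 0) (a : Fin M → ℝ) :
    coordLaw v a = ((uniformOn (Set.univ : Set (Fin M))).prod (gaussianReal 0 v)).map
      fun p => (p.1, a p.1 + p.2) := by
  have hg := measurable_shift a
  ext s hs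
  rw [Measure.map_apply hg hs, Measure.prod_apply (hg hs), coordLaw, withDensity_apply _ hs,
    ← lintegral_indicator hs,
    lintegral_prod _ ((measurable_coordDensity v a).indicator hs).aemeasurable]
  refine lintegral_congr fun i => ?_
  have h1 : MeasurableSet (Prod.mk i ⁻¹' s) := measurable_prodMk_left hs
  have h2 : (Prod.mk i ⁻¹' ((fun p : Fin M × ℝ => (p.1, a p.1 + p.2)) ⁻¹' s)) =
      (a i + ·) ⁻¹' (Prod.mk i ⁻¹' s) := rfl
  rw [h2, ← Measure.map_apply (measurable_const_add _) h1, gaussianReal_map_const_add, zero_add,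
    gaussianReal_apply _ hv, ← lintegral_indicator h1]
  rfl

instance isProbabilityMeasure_uniformOn_fin {M : ℕ} [NeZero M] :
    IsProbabilityMeasure (uniformOn (Set.univ : Set (Fin M))) :=
  isProbabilityMeasure_uniformOn Set.finite_univ Set.univ_nonempty

theorem isProbabilityMeasure_coordLaw {M : ℕ} [NeZero M] {v : ℝ≥0} (hv : v ≠ 0)
    (a : Fin M → ℝ) : IsProbabilityMeasure (coordLaw v a) := by
  rw [coordLaw_eq_map hv]
  exact Measure.isProbabilityMeasure_map
    (measurable_shift a).aemeasurable

theorem obsLaw_eq_map {m : ℕ} {σ : ℝ≥0} (hσ : 0 < σ) (E : Fin (m ^ 2) → Matrix (Fin m) (Fin m) ℂ)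
    (ρ : DensityMatrix m) :
    obsLaw E σ ρ = (coordLaw (σ ^ 2) fun i => hsInner ρ.1 (E i)).map fun p => (E p.1, p.2) := by
  rw [coordLaw_eq_map (pow_pos hσ 2).ne', Measure.map_map]
  · rfl
  · exact measurable_design E
  · exact measurable_shift fun i => hsInner ρ.1 (E i)

theorem sampleLaw_eq_map {m : ℕ} [NeZero (m ^ 2)] {σ : ℝ≥0} (hσ : 0 < σ) (n : ℕ)
    (E : Fin (m ^ 2) → Matrix (Fin m) (Fin m) ℂ) (ρ : DensityMatrix m) :
    sampleLaw n E σ ρ =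
      (Measure.pi fun _ : Fin n => coordLaw (σ ^ 2) fun i => hsInner ρ.1 (E i)).map
        fun x j => (E (x j).1, (x j).2) := by
  have hm := measurable_design E
  have := isProbabilityMeasure_coordLaw (pow_pos hσ 2).ne' fun i => hsInner ρ.1 (E i)
  have : IsProbabilityMeasure ((coordLaw (σ ^ 2) fun i => hsInner ρ.1 (E i)).map
      fun p => (E p.1, p.2)) := Measure.isProbabilityMeasure_map hm.aemeasurable
  rw [sampleLaw, obsLaw_eq_map hσ, ← Measure.pi_map_pi fun _ => hm.aemeasurable]

theorem isProbabilityMeasure_sampleLaw {m : ℕ} [NeZero (m ^ 2)] {σ : ℝ≥0} (hσ : 0 < σ) (n : ℕ)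
    (E : Fin (m ^ 2) → Matrix (Fin m) (Fin m) ℂ) (ρ : DensityMatrix m) :
    IsProbabilityMeasure (sampleLaw n E σ ρ) := by
  have := isProbabilityMeasure_coordLaw (pow_pos hσ 2).ne' fun i => hsInner ρ.1 (E i)
  rw [sampleLaw_eq_map hσ]
  refine Measure.isProbabilityMeasure_map (Measurable.aemeasurable ?_)
  have hm := measurable_design E
  exact measurable_pi_lambda _ fun j => hm.comp (measurable_pi_apply j)

/-- Two regression functions have Hellinger affinity at least one minus their mean squared distance
over eight times the noise variance. -/
theorem affinity_coordLaw {M : ℕ} [NeZero M] {v : ℝ≥0} (hv : v ≠ 0) (a b : Fin M → ℝ) :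
    ENNReal.ofReal (1 - (∑ i, (a i - b i) ^ 2) / (8 * v * M)) ≤
      ∫⁻ p, (gaussianPDF (a p.1) v p.2 * gaussianPDF (b p.1) v p.2) ^ (1 / 2 : ℝ)
        ∂((uniformOn (Set.univ : Set (Fin M))).prod volume) := by
  rw [lintegral_prod (fun p : Fin M × ℝ =>
      (gaussianPDF (a p.1) v p.2 * gaussianPDF (b p.1) v p.2) ^ (1 / 2 : ℝ))
    (((measurable_coordDensity v a).mul (measurable_coordDensity v b)).pow_const _).aemeasurable]
  simp_rw [lintegral_sqrt_gaussianPDF _ _ hv]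
  have hM : (M : ℝ) ≠ 0 := Nat.cast_ne_zero.2 (NeZero.ne M)
  have hM' : (0 : ℝ) < M := Nat.cast_pos.2 (NeZero.pos M)
  have hv' : (v : ℝ) ≠ 0 := by exact_mod_cast hv
  rw [lintegral_fintype]
  have hsing : ∀ i : Fin M, uniformOn (Set.univ : Set (Fin M)) {i} = ENNReal.ofReal (1 / M) := by
    intro i
    rw [uniformOn_univ, Measure.count_singleton, Fintype.card_fin, ENNReal.ofReal_div_of_pos hM']
    simp
  simp_rw [hsing, ← ENNReal.ofReal_mul (Real.exp_nonneg _)]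
  rw [← ENNReal.ofReal_sum_of_nonneg fun i _ => by positivity]
  refine ENNReal.ofReal_le_ofReal ?_
  have : ∀ i, (1 - (a i - b i) ^ 2 / (8 * v)) * (1 / M) ≤
      Real.exp (-(a i - b i) ^ 2 / (8 * v)) * (1 / M) := fun i => by
    refine mul_le_mul_of_nonneg_right ?_ (by positivity)
    have := Real.add_one_le_exp (-(a i - b i) ^ 2 / (8 * v))
    rw [neg_div] at this ⊢
    linarith
  refine le_trans (le_of_eq ?_) (Finset.sum_le_sum fun i _ => this i)
  rw [← Finset.sum_mul, Finset.sum_sub_distrib, ← Finset.sum_div]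
  simp
  field_simp

/-- The affinity of `n`-fold products is at least `1 / 2` if that of the factors is at least
`1 - x` with `n * x ≤ 1 / 2`. -/
theorem errors_ge_pi {Ω : Type*} [MeasurableSpace Ω] (μ : Measure Ω) [SigmaFinite μ]
    {f g : Ω → ℝ≥0∞} (hf : Measurable f) (hg : Measurable g)
    [IsProbabilityMeasure (μ.withDensity f)] [IsProbabilityMeasure (μ.withDensity g)]
    (n : ℕ) {x : ℝ} (hx0 : 0 ≤ x) (hxn : n * x ≤ 1 / 2)
    (h : ENNReal.ofReal (1 - x) ≤ ∫⁻ y, (f y * g y) ^ (1 / 2 : ℝ) ∂μ) {A : Set (Fin n → Ω)}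
    (hA : MeasurableSet A) :
    1 / 8 ≤ (Measure.pi fun _ : Fin n => μ.withDensity f).real A +
      (Measure.pi fun _ : Fin n => μ.withDensity g).real Aᶜ := by
  have pf : IsProbabilityMeasure (Measure.pi fun _ : Fin n => μ.withDensity f) := inferInstance
  have pg : IsProbabilityMeasure (Measure.pi fun _ : Fin n => μ.withDensity g) := inferInstance
  rw [pi_withDensity μ n hf] at pf ⊢
  rw [pi_withDensity μ n hg] at pg ⊢
  have hprod : ∀ k : Ω → ℝ≥0∞, Measurable k → Measurable fun x : Fin n → Ω => ∏ i, k (x i) :=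
    fun k hk => Finset.measurable_prod _ fun i _ => hk.comp (measurable_pi_apply i)
  have haff : ENNReal.ofReal (1 / 2) ≤ ∫⁻ x : Fin n → Ω,
      ((∏ i, f (x i)) * ∏ i, g (x i)) ^ (1 / 2 : ℝ) ∂(Measure.pi fun _ => μ) := by
    have hre : ∀ x : Fin n → Ω, ((∏ i, f (x i)) * ∏ i, g (x i)) ^ (1 / 2 : ℝ) =
        ∏ i, (f (x i) * g (x i)) ^ (1 / 2 : ℝ) := fun x => by
      rw [← Finset.prod_mul_distrib, ENNReal.prod_rpow_of_nonneg (by norm_num)]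
    rw [lintegral_congr hre]
    have := lintegral_pi_prod μ n (fun _ y => (f y * g y) ^ (1 / 2 : ℝ))
      fun _ => (hf.mul hg).pow_const _
    rw [this, Finset.prod_const, Finset.card_univ, Fintype.card_fin]
    refine le_trans ?_ (pow_le_pow_left' h n)
    rcases Nat.eq_zero_or_pos n with rfl | hn
    · rw [pow_zero]
      exact ENNReal.ofReal_le_one.2 (by norm_num)
    have hn' : (1 : ℝ) ≤ n := by exact_mod_cast hn
    have hx1 : x ≤ 1 := by linarith [mul_nonneg hx0 (sub_nonneg.2 hn')]
    rw [← ENNReal.ofReal_pow (by linarith)]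
    refine ENNReal.ofReal_le_ofReal ?_
    have := one_add_mul_le_pow (a := -x) (by linarith) n
    rw [← sub_eq_add_neg] at this
    linarith
  have key := sq_affinity_le_errors _ (hprod f hf) (hprod g hg) (b := 1 / 2) (by norm_num) haff hA
  refine le_trans (by norm_num) key

/-- Two regression functions that are close, relative to the noise, cannot be told apart from
`n` observations. -/
theorem errors_ge_coordLaw {M : ℕ} [NeZero M] {v : ℝ≥0} (hv : v ≠ 0) (n : ℕ) (a b : Fin M → ℝ)
    (h : n * ∑ i, (a i - b i) ^ 2 ≤ 4 * v * M) {A : Set (Fin n → Fin M × ℝ)}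
    (hA : MeasurableSet A) :
    1 / 8 ≤ (Measure.pi fun _ : Fin n => coordLaw v a).real A +
      (Measure.pi fun _ : Fin n => coordLaw v b).real Aᶜ := by
  have pa : IsProbabilityMeasure (coordLaw v a) := isProbabilityMeasure_coordLaw hv a
  have pb : IsProbabilityMeasure (coordLaw v b) := isProbabilityMeasure_coordLaw hv b
  have hv' : (0 : ℝ) < v := by exact_mod_cast pos_iff_ne_zero.2 hv
  have hM : (0 : ℝ) < M := by exact_mod_cast NeZero.pos M
  have hS : 0 ≤ ∑ i, (a i - b i) ^ 2 := Finset.sum_nonneg fun i _ => sq_nonneg _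
  unfold coordLaw at pa pb ⊢
  refine errors_ge_pi _ (measurable_coordDensity v a) (measurable_coordDensity v b) n
    (x := (∑ i, (a i - b i) ^ 2) / (8 * v * M)) (div_nonneg hS (by positivity)) ?_
    (affinity_coordLaw hv a b) hA
  rw [← mul_div_assoc, div_le_iff₀ (by positivity)]
  linarith

/-! ### Bessel's inequality -/

theorem hsInner_comm {m : ℕ} (A B : Matrix (Fin m) (Fin m) ℂ) : hsInner A B = hsInner B A := by
  rw [hsInner, Matrix.trace_mul_comm, hsInner]

theorem hsInner_sub_left {m : ℕ} (A B C : Matrix (Fin m) (Fin m) ℂ) :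
    hsInner (A - B) C = hsInner A C - hsInner B C := by
  simp [hsInner, sub_mul]

theorem hsInner_sum_smul_left {m : ℕ} {ι : Type*} (s : Finset ι) (c : ι → ℝ)
    (A : ι → Matrix (Fin m) (Fin m) ℂ) (C : Matrix (Fin m) (Fin m) ℂ) :
    hsInner (∑ i ∈ s, c i • A i) C = ∑ i ∈ s, c i * hsInner (A i) C := by
  simp [hsInner, Finset.sum_mul, Matrix.trace_sum]

theorem hsInner_self_nonneg {m : ℕ} {A : Matrix (Fin m) (Fin m) ℂ} (hA : A.IsHermitian) :
    0 ≤ hsInner A A := by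
  have h := (Matrix.posSemidef_conjTranspose_mul_self A).trace_nonneg
  rw [hA.eq] at h
  exact (Complex.le_def.1 h).1

/-- Bessel's inequality for the sampling basis; only its orthonormality enters. -/
theorem sum_hsInner_sq_le {m : ℕ} {E : Fin (m ^ 2) → Matrix (Fin m) (Fin m) ℂ}
    (hE : IsOrthonormalBasis E) {D : Matrix (Fin m) (Fin m) ℂ} (hD : D.IsHermitian) :
    ∑ i, hsInner D (E i) ^ 2 ≤ hsInner D D := by
  set C := D - ∑ i, hsInner D (E i) • E i with hC
  have hCh : C.IsHermitian := hD.sub (by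
    simp only [Matrix.IsHermitian, Matrix.conjTranspose_sum, Matrix.conjTranspose_smul,
      (hE.isHermitian _).eq, star_trivial])
  have hCE : ∀ j, hsInner C (E j) = 0 := fun j => by
    rw [hC, hsInner_sub_left, hsInner_sum_smul_left]
    simp [hE.orthonormal]
  have h1 : hsInner C C = hsInner D D - ∑ i, hsInner D (E i) ^ 2 := by
    have : hsInner C C = hsInner D C - ∑ i, hsInner D (E i) * hsInner (E i) C := by
      conv_lhs => rw [hC, hsInner_sub_left, hsInner_sum_smul_left]
    rw [this]
    simp only [hsInner_comm (E _) C, hCE, mul_zero, Finset.sum_const_zero, sub_zero]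
    rw [hsInner_comm, hC, hsInner_sub_left, hsInner_sum_smul_left]
    simp only [sq, hsInner_comm]
  linarith [hsInner_self_nonneg hCh]

/-- Two states at Hilbert–Schmidt distance at most `2 σ m / √n` cannot be told apart from the
sample. -/
theorem errors_ge_of_close {m : ℕ} [NeZero (m ^ 2)] {σ : ℝ≥0} (hσ : 0 < σ) (n : ℕ)
    {E : Fin (m ^ 2) → Matrix (Fin m) (Fin m) ℂ} (hE : IsOrthonormalBasis E)
    (ρ ρ' : DensityMatrix m)
    (h : n * hsInner (ρ.1 - ρ'.1) (ρ.1 - ρ'.1) ≤ 4 * (σ : ℝ) ^ 2 * (m : ℝ) ^ 2)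
    {A : Set (Fin n → Matrix (Fin m) (Fin m) ℂ × ℝ)} (hA : MeasurableSet A) :
    1 / 8 ≤ (sampleLaw n E σ ρ).real A + (sampleLaw n E σ ρ').real Aᶜ := by
  have hm' : Measurable fun (x : Fin n → Fin (m ^ 2) × ℝ) j => (E (x j).1, (x j).2) :=
    measurable_pi_lambda _ fun j => (measurable_design E).comp (measurable_pi_apply j)
  rw [sampleLaw_eq_map hσ, sampleLaw_eq_map hσ, map_measureReal_apply hm' hA,
    map_measureReal_apply hm' hA.compl, Set.preimage_compl]
  refine errors_ge_coordLaw (pow_pos hσ 2).ne' n _ _ ?_ (hm' hA)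
  push_cast
  refine le_trans ?_ h
  simp only [← hsInner_sub_left]
  exact mul_le_mul_of_nonneg_left
    (sum_hsInner_sq_le hE (ρ.2.1.isHermitian.sub ρ'.2.1.isHermitian)) (by positivity)

/-! ### Assouad's lemma in probability -/

/-- The sign pattern `ε` with its bit `b` flipped. -/
def flipBit {ι : Type*} [DecidableEq ι] (ε : ι → Bool) (b : ι) : ι → Bool :=
  Function.update ε b (!ε b)

@[simp] theorem flipBit_same {ι : Type*} [DecidableEq ι] (ε : ι → Bool) (b : ι) :
    flipBit ε b b = !ε b := by simp [flipBit]

theorem flipBit_of_ne {ι : Type*} [DecidableEq ι] (ε : ι → Bool) {b c : ι} (h : c ≠ b) :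
    flipBit ε b c = ε c := by simp [flipBit, h]

theorem flipBit_flipBit {ι : Type*} [DecidableEq ι] (ε : ι → Bool) (b : ι) :
    flipBit (flipBit ε b) b = ε := by simp [flipBit]

theorem sum_flipBit {ι : Type*} [DecidableEq ι] [Fintype ι] (b : ι) (f : (ι → Bool) → ℝ) :
    ∑ ε, f (flipBit ε b) = ∑ ε, f ε :=
  Equiv.sum_comp (Function.Involutive.toPerm (fun ε => flipBit ε b)
    fun ε => flipBit_flipBit ε b) f

/-- A measurable decoder: it picks a member of `𝒢` among those whose bad event did not happen. -/
theorem exists_decoder {Ω κ : Type*} [MeasurableSpace Ω] [Fintype κ] [Nonempty κ]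
    (𝒢 : Finset κ) (B : κ → Set Ω) (hB : ∀ ε, MeasurableSet (B ε)) :
    ∃ φ : Ω → κ, (∀ s : Set κ, MeasurableSet (φ ⁻¹' s)) ∧
      ∀ ω, ∀ ε ∈ 𝒢, ω ∉ B ε → φ ω ∈ 𝒢 ∧ ω ∉ B (φ ω) := by
  classical
  let T : Ω → Finset κ := fun ω => {ε ∈ 𝒢 | ω ∉ B ε}
  let c : Finset κ → κ := fun F => if h : F.Nonempty then h.choose else Classical.arbitrary κ
  refine ⟨fun ω => c (T ω), fun s => ?_, fun ω ε hε hω => ?_⟩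
  · have hT : ∀ F, MeasurableSet (T ⁻¹' {F}) := fun F => by
      have : T ⁻¹' {F} = ⋂ ε, {ω | ε ∈ T ω ↔ ε ∈ F} := by
        ext ω
        simp [Finset.ext_iff]
      rw [this]
      refine MeasurableSet.iInter fun ε => ?_
      by_cases h1 : ε ∈ 𝒢 <;> by_cases h2 : ε ∈ F
      · have : {ω | ε ∈ T ω ↔ ε ∈ F} = (B ε)ᶜ := by
          ext ω
          simp [T, h1, h2]
        exact this ▸ (hB ε).compl
      · simpa [T, h1, h2] using hB ε
      · simp [T, h1, h2]
      · simp [T, h1, h2]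
    have : (fun ω => c (T ω)) ⁻¹' s = ⋃ F ∈ {F | c F ∈ s}, T ⁻¹' {F} := by
      ext ω
      simp
    rw [this]
    exact MeasurableSet.biUnion (Set.to_countable _) fun F _ => hT F
  · have hne : (T ω).Nonempty := ⟨ε, by simp [T, hε, hω]⟩
    have : c (T ω) ∈ T ω := by
      simp only [c, dif_pos hne]
      exact hne.choose_spec
    simpa [T] using this

/-- The number of wrong bits has average at least `α / 2` times the number of bits. -/
theorem assouad_sum {Ω ι : Type*} [MeasurableSpace Ω] [Fintype ι] [DecidableEq ι]
    (P : (ι → Bool) → Measure Ω) {α : ℝ}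
    (haff : ∀ ε b (A : Set Ω), MeasurableSet A → α ≤ (P ε).real A + (P (flipBit ε b)).real Aᶜ)
    (φ : Ω → ι → Bool) (hφ : ∀ s : Set (ι → Bool), MeasurableSet (φ ⁻¹' s)) :
    2 ^ Fintype.card ι * (Fintype.card ι * (α / 2)) ≤
      ∑ ε, ∑ b, (P ε).real {ω | φ ω b ≠ ε b} := by
  rw [Finset.sum_comm]
  -- pair each pattern with its neighbour at `b`: the two error events are complementary
  have hb : ∀ b, 2 ^ Fintype.card ι * (α / 2) ≤ ∑ ε, (P ε).real {ω | φ ω b ≠ ε b} := fun b => by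
    have h1 : ∀ ε, α ≤ (P ε).real {ω | φ ω b ≠ ε b} +
        (P (flipBit ε b)).real {ω | φ ω b ≠ flipBit ε b b} := fun ε => by
      convert haff ε b {ω | φ ω b ≠ ε b} (hφ {δ | δ b ≠ ε b}) using 3
      ext ω
      cases h : ε b <;> cases h' : φ ω b <;> simp [h, h']
    have h2 := Finset.sum_le_sum fun ε (_ : ε ∈ Finset.univ) => h1 ε
    rw [Finset.sum_add_distrib,
      sum_flipBit b fun ε => (P ε).real {ω | φ ω b ≠ ε b}] at h2
    simp only [Finset.sum_const, Finset.card_univ, Fintype.card_fun, Fintype.card_bool,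
      nsmul_eq_mul, Nat.cast_pow, Nat.cast_ofNat] at h2
    linarith
  have h3 := Finset.sum_le_sum fun b (_ : b ∈ Finset.univ) => hb b
  simp only [Finset.sum_const, Finset.card_univ, nsmul_eq_mul] at h3
  linarith

/-- If the number of wrong bits is small off an event `B`, then so is its mean, up to the
probability of `B`. -/
theorem sum_wrong_le {Ω ι : Type*} [MeasurableSpace Ω] [Fintype ι] (P : Measure Ω)
    [IsProbabilityMeasure P] (φ : Ω → ι → Bool)
    (hφ : ∀ s : Set (ι → Bool), MeasurableSet (φ ⁻¹' s)) (ε : ι → Bool) {B : Set Ω}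
    (hB : MeasurableSet B) {k : ℝ} (hk : 0 ≤ k)
    (h : ∀ ω, ω ∉ B → (hammingDist (φ ω) ε : ℝ) ≤ k) :
    ∑ b, P.real {ω | φ ω b ≠ ε b} ≤ k + Fintype.card ι * P.real B := by
  classical
  have hC : ∀ b, MeasurableSet {ω | φ ω b ≠ ε b} := fun b => hφ {δ | δ b ≠ ε b}
  have h1 : ∀ b, P.real {ω | φ ω b ≠ ε b} ≤ P.real ({ω | φ ω b ≠ ε b} \ B) + P.real B :=
    fun b => by
      refine (measureReal_mono ?_).trans (measureReal_union_le _ _)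
      intro ω hω
      by_cases hb : ω ∈ B
      · exact Or.inr hb
      · exact Or.inl ⟨hω, hb⟩
  have h2 : ∑ b, P.real ({ω | φ ω b ≠ ε b} \ B) ≤ k := by
    have : ∀ b, P.real ({ω | φ ω b ≠ ε b} \ B) =
        ∫ ω, ({ω | φ ω b ≠ ε b} \ B).indicator (fun _ => (1 : ℝ)) ω ∂P := fun b => by
      rw [integral_indicator_const _ ((hC b).diff hB)]
      simp
    simp_rw [this]
    rw [← integral_finsetSum _ fun b _ =>
      (integrable_const (1 : ℝ)).indicator ((hC b).diff hB)]
    have hle : ∀ ω, ∑ b, ({ω | φ ω b ≠ ε b} \ B).indicator (fun _ => (1 : ℝ)) ω ≤ k := fun ω => by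
      by_cases hω : ω ∈ B
      · simpa [Set.indicator, hω] using hk
      · refine le_trans (le_of_eq ?_) (h ω hω)
        rw [hammingDist, Finset.card_filter]
        push_cast
        exact Finset.sum_congr rfl fun b _ => by simp [Set.indicator, hω]
    refine (integral_mono (integrable_finsetSum _ fun b _ =>
      (integrable_const (1 : ℝ)).indicator ((hC b).diff hB)) (integrable_const k) hle).trans ?_
    simp
  calc _ ≤ ∑ b, (P.real ({ω | φ ω b ≠ ε b} \ B) + P.real B) := Finset.sum_le_sum fun b _ => h1 b
    _ ≤ _ := by
      rw [Finset.sum_add_distrib]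
      simpa using h2

/-- **Assouad's lemma in probability.** Let neighbouring sign patterns have laws that cannot be
told apart, and let bad events `A ε` be given such that, on the part `𝒢` of the cube (most of it),
two patterns whose bad events both fail are close in Hamming distance. Then some bad event is
likely. The sets `A ε` need not be measurable. -/
theorem assouad_prob {Ω ι : Type*} [MeasurableSpace Ω] [Fintype ι] [DecidableEq ι] [Nonempty ι]
    (P : (ι → Bool) → Measure Ω) [∀ ε, IsProbabilityMeasure (P ε)] {α : ℝ} (hα : 0 < α)
    (haff : ∀ ε b (A : Set Ω), MeasurableSet A → α ≤ (P ε).real A + (P (flipBit ε b)).real Aᶜ)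
    (𝒢 : Finset (ι → Bool)) (h𝒢 : (𝒢ᶜ.card : ℝ) ≤ α / 16 * 2 ^ Fintype.card ι)
    (A : (ι → Bool) → Set Ω)
    (hsep : ∀ ε ∈ 𝒢, ∀ ε' ∈ 𝒢, ∀ ω, ω ∉ A ε → ω ∉ A ε' →
      (hammingDist ε ε' : ℝ) ≤ α / 8 * Fintype.card ι) :
    ∃ ε ∈ 𝒢, α / 8 ≤ (P ε).real (A ε) := by
  by_contra! hcon
  -- measurable hulls of the bad events have the same probabilities and fail less often
  have hBr : ∀ ε, (P ε).real (toMeasurable (P ε) (A ε)) = (P ε).real (A ε) := fun ε => by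
    rw [measureReal_def, measure_toMeasurable, measureReal_def]
  obtain ⟨φ, hφ, hφ'⟩ := exists_decoder 𝒢 (fun ε => toMeasurable (P ε) (A ε))
    fun ε => measurableSet_toMeasurable _ _
  have hlow := assouad_sum P haff φ hφ
  have hN : (0 : ℝ) < Fintype.card ι := by exact_mod_cast Fintype.card_pos
  have hgood : ∀ ε ∈ 𝒢, ∑ b, (P ε).real {ω | φ ω b ≠ ε b} ≤ Fintype.card ι * (α / 4) := by
    intro ε hε
    have := sum_wrong_le (P ε) φ hφ ε (measurableSet_toMeasurable (P ε) (A ε))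
      (k := α / 8 * Fintype.card ι) (by positivity) fun ω hω => by
        obtain ⟨h1, h2⟩ := hφ' ω ε hε hω
        exact hsep _ h1 ε hε ω (fun h => h2 (subset_toMeasurable _ _ h))
          fun h => hω (subset_toMeasurable _ _ h)
    rw [hBr] at this
    nlinarith [hcon ε hε]
  have hbad : ∀ ε, ∑ b, (P ε).real {ω | φ ω b ≠ ε b} ≤ Fintype.card ι := fun ε => by
    refine (Finset.sum_le_sum fun b _ => measureReal_le_one).trans ?_
    simp
  have hup : ∑ ε, ∑ b, (P ε).real {ω | φ ω b ≠ ε b} ≤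
      2 ^ Fintype.card ι * (Fintype.card ι * (α / 4)) +
        α / 16 * 2 ^ Fintype.card ι * Fintype.card ι := by
    rw [← Finset.sum_add_sum_compl 𝒢]
    refine add_le_add ?_ ?_
    · refine (Finset.sum_le_sum hgood).trans ?_
      rw [Finset.sum_const, nsmul_eq_mul]
      refine mul_le_mul_of_nonneg_right ?_ (by positivity)
      have := Finset.card_le_univ 𝒢
      simp only [Fintype.card_fun, Fintype.card_bool] at this
      exact_mod_cast this
    · refine (Finset.sum_le_sum fun ε _ => hbad ε).trans ?_
      rw [Finset.sum_const, nsmul_eq_mul]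
      exact mul_le_mul_of_nonneg_right h𝒢 hN.le
  have hpos : (0 : ℝ) < 2 ^ Fintype.card ι * Fintype.card ι * α := by positivity
  nlinarith

/-! ### Frobenius norm, contractions and the polar factor -/

section Frobenius

variable {k l p : Type*}

/-- The squared Frobenius norm. -/
def frobSq [Fintype k] [Fintype l] (X : Matrix k l ℂ) : ℝ := ∑ i, ∑ j, ‖X i j‖ ^ 2

theorem frobSq_nonneg [Fintype k] [Fintype l] (X : Matrix k l ℂ) : 0 ≤ frobSq X := by
  unfold frobSq; positivity

theorem frobSq_conjTranspose [Fintype k] [Fintype l] (X : Matrix k l ℂ) : frobSq Xᴴ = frobSq X := by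
  rw [frobSq, frobSq, Finset.sum_comm]
  simp

theorem frobSq_smul [Fintype k] [Fintype l] (c : ℂ) (X : Matrix k l ℂ) :
    frobSq (c • X) = ‖c‖ ^ 2 * frobSq X := by
  simp [frobSq, mul_pow, Finset.mul_sum]

theorem frobSq_add_le [Fintype k] [Fintype l] (X Y : Matrix k l ℂ) :
    frobSq (X + Y) ≤ 2 * frobSq X + 2 * frobSq Y := by
  simp only [frobSq, Finset.mul_sum, ← Finset.sum_add_distrib]
  refine Finset.sum_le_sum fun i _ => Finset.sum_le_sum fun j _ => ?_
  have := norm_add_le (X i j) (Y i j)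
  rw [Matrix.add_apply]
  nlinarith [norm_nonneg (X i j), norm_nonneg (Y i j), norm_nonneg (X i j + Y i j),
    sq_nonneg (‖X i j‖ - ‖Y i j‖)]

theorem trace_conjTranspose_mul_self [Fintype k] [Fintype l] (X : Matrix k l ℂ) :
    (Xᴴ * X).trace = (frobSq X : ℂ) := by
  simp only [Matrix.trace, Matrix.diag, Matrix.mul_apply, Matrix.conjTranspose_apply, frobSq]
  rw [Finset.sum_comm]
  push_cast
  refine Finset.sum_congr rfl fun i _ => Finset.sum_congr rfl fun j _ => ?_
  exact RCLike.conj_mul (X i j)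

theorem norm_trace_conjTranspose_mul_le [Fintype k] [Fintype l] (X Y : Matrix k l ℂ) :
    ‖(Xᴴ * Y).trace‖ ≤ √(frobSq X) * √(frobSq Y) := by
  have h1 : ‖(Xᴴ * Y).trace‖ ≤ ∑ x : k × l, ‖X x.1 x.2‖ * ‖Y x.1 x.2‖ := by
    simp only [Matrix.trace, Matrix.diag, Matrix.mul_apply, Matrix.conjTranspose_apply]
    rw [Finset.sum_comm, ← Finset.sum_product', Finset.univ_product_univ]
    refine (norm_sum_le _ _).trans (le_of_eq ?_)
    simp
  refine h1.trans ((Real.sum_mul_le_sqrt_mul_sqrt _ _ _).trans (le_of_eq ?_))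
  rw [frobSq, frobSq, ← Finset.univ_product_univ, Finset.sum_product, Finset.sum_product]

/-- A contraction for the Euclidean norms: `Uᴴ U ≤ 1`. -/
def IsContraction [Fintype k] [DecidableEq l] (U : Matrix k l ℂ) : Prop := (1 - Uᴴ * U).PosSemidef

theorem IsContraction.frobSq_mul_le [Fintype k] [Fintype l] [Fintype p] [DecidableEq l]
    {U : Matrix k l ℂ} (hU : IsContraction U) (X : Matrix l p ℂ) :
    frobSq (U * X) ≤ frobSq X := by
  have h := (hU.conjTranspose_mul_mul_same X).trace_nonneg
  have h2 : Xᴴ * (1 - Uᴴ * U) * X = Xᴴ * X - (U * X)ᴴ * (U * X) := by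
    simp only [Matrix.mul_sub, Matrix.sub_mul, Matrix.conjTranspose_mul, Matrix.mul_one,
      Matrix.mul_assoc]
  rw [h2, Matrix.trace_sub, trace_conjTranspose_mul_self, trace_conjTranspose_mul_self] at h
  have := (Complex.le_def.1 h).1
  simpa using this

theorem IsContraction.conjTranspose [Fintype k] [Fintype l] [DecidableEq k] [DecidableEq l]
    {U : Matrix k l ℂ} (hU : IsContraction U) :
    IsContraction Uᴴ := by
  have h : (1 : Matrix k k ℂ) - Uᴴᴴ * Uᴴ =
      (1 - U * Uᴴ)ᴴ * (1 - U * Uᴴ) + U * (1 - Uᴴ * U) * Uᴴ := by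
    simp only [Matrix.mul_sub, Matrix.sub_mul, Matrix.conjTranspose_mul, Matrix.mul_one,
      Matrix.one_mul, Matrix.mul_assoc, Matrix.conjTranspose_conjTranspose,
      Matrix.conjTranspose_sub, Matrix.conjTranspose_one]
    abel
  rw [IsContraction, h]
  exact (Matrix.posSemidef_conjTranspose_mul_self _).add (hU.mul_mul_conjTranspose_same U)

theorem IsContraction.mul [Fintype k] [Fintype l] [Fintype p] [DecidableEq l] [DecidableEq p]
    {U : Matrix k l ℂ} {V : Matrix l p ℂ}
    (hU : IsContraction U) (hV : IsContraction V) : IsContraction (U * V) := by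
  have h : 1 - (U * V)ᴴ * (U * V) = (1 - Vᴴ * V) + Vᴴ * (1 - Uᴴ * U) * V := by
    simp only [Matrix.mul_sub, Matrix.sub_mul, Matrix.conjTranspose_mul, Matrix.mul_one,
      Matrix.mul_assoc]
    abel
  rw [IsContraction, h]
  exact hV.add (hU.conjTranspose_mul_mul_same V)

theorem isContraction_of_isometry [Fintype k] [DecidableEq l]
    {U : Matrix k l ℂ} (hU : Uᴴ * U = 1) : IsContraction U := by
  rw [IsContraction, hU, sub_self]
  exact Matrix.PosSemidef.zero

theorem frobSq_mul_of_isometry [Fintype k] [Fintype l] [Fintype p] [DecidableEq l]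
    {U : Matrix k l ℂ} (hU : Uᴴ * U = 1) (X : Matrix l p ℂ) :
    frobSq (U * X) = frobSq X := by
  have : (U * X)ᴴ * (U * X) = Xᴴ * X := by
    rw [Matrix.conjTranspose_mul, Matrix.mul_assoc, ← Matrix.mul_assoc Uᴴ, hU, Matrix.one_mul]
  have h := trace_conjTranspose_mul_self (U * X)
  rw [this, trace_conjTranspose_mul_self] at h
  exact_mod_cast h.symm

theorem IsContraction.frobSq_le [Fintype k] [Fintype l] [DecidableEq l]
    {U : Matrix k l ℂ} (hU : IsContraction U) :
    frobSq U ≤ Fintype.card l := by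
  have := hU.frobSq_mul_le (1 : Matrix l l ℂ)
  rw [Matrix.mul_one] at this
  refine this.trans (le_of_eq ?_)
  have h := trace_conjTranspose_mul_self (1 : Matrix l l ℂ)
  simp only [Matrix.conjTranspose_one, Matrix.mul_one, Matrix.trace_one] at h
  exact_mod_cast h.symm

theorem trace_cfc [Fintype l] [DecidableEq l] {A : Matrix l l ℂ} (hA : A.IsHermitian) (f : ℝ → ℝ) :
    (cfc f A).trace = ((∑ i, f (hA.eigenvalues i) : ℝ) : ℂ) := by
  rw [hA.cfc_eq, Matrix.IsHermitian.cfc, Unitary.conjStarAlgAut_apply, Matrix.trace_mul_cycle,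
    Unitary.coe_star_mul_self, Matrix.one_mul, Matrix.trace_diagonal]
  simp

theorem posSemidef_cfc [Fintype l] [DecidableEq l] {A : Matrix l l ℂ} (hA : A.IsHermitian)
    {f : ℝ → ℝ} (hf : ∀ x, 0 ≤ f x) :
    (cfc f A).PosSemidef := by
  rw [hA.cfc_eq, Matrix.IsHermitian.cfc, Unitary.conjStarAlgAut_apply]
  refine Matrix.PosSemidef.mul_mul_conjTranspose_same (Matrix.PosSemidef.diagonal fun i => ?_) _
  simpa using hf _

theorem cfc_mul_matrix [Fintype l] [DecidableEq l] {A : Matrix l l ℂ} (f g : ℝ → ℝ) :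
    cfc (fun x => f x * g x) A = cfc f A * cfc g A :=
  have hfin : (spectrum ℝ A).Finite := Matrix.finite_real_spectrum
  cfc_mul f g A (hfin.continuousOn _) (hfin.continuousOn _)

/-- The polar factor of `M`, zero on the kernel of `M`. -/
theorem exists_polar [Fintype k] [Fintype l] [DecidableEq l] (M : Matrix k l ℂ) :
    ∃ U : Matrix k l ℂ, IsContraction U ∧ Uᴴ * M = cfc Real.sqrt (Mᴴ * M) := by
  have hM : (Mᴴ * M).IsHermitian := Matrix.isHermitian_conjTranspose_mul_self M
  set T := Mᴴ * M with hT
  have hsa : IsSelfAdjoint T := hM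
  set N := cfc (fun x : ℝ => (√x)⁻¹) T with hN
  have hNh : Nᴴ = N := by
    have : IsSelfAdjoint N := cfc_predicate _ _
    exact this
  have hid : cfc (fun x : ℝ => x) T = T := cfc_id' ℝ T
  have h1 : N * T = cfc Real.sqrt T := by
    rw [hN]
    nth_rewrite 2 [← hid]
    rw [← cfc_mul_matrix]
    congr 1
    ext x
    -- for `x ≤ 0` both sides vanish, as `√x = 0` and `0⁻¹ = 0`
    rcases le_total x 0 with hx | hx
    · simp [Real.sqrt_eq_zero_of_nonpos hx]
    · rcases hx.eq_or_lt with rfl | hx'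
      · simp
      · have := Real.sqrt_pos.2 hx'
        field_simp
        exact (Real.sq_sqrt hx).symm
  refine ⟨M * N, ?_, ?_⟩
  · have h2 : 1 - (M * N)ᴴ * (M * N) = cfc (fun x : ℝ => 1 - √x * (√x)⁻¹) T := by
      rw [cfc_sub (fun _ => (1 : ℝ)) (fun x : ℝ => √x * (√x)⁻¹) T
        (Matrix.finite_real_spectrum.continuousOn _) (Matrix.finite_real_spectrum.continuousOn _),
        cfc_const_one ℝ T, cfc_mul_matrix, ← h1, ← hN, Matrix.conjTranspose_mul, hNh, hT]
      simp only [Matrix.mul_assoc]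
    rw [IsContraction, h2]
    refine posSemidef_cfc hM fun x => ?_
    by_cases hx : √x = 0
    · simp [hx]
    · simp [hx]
  · rw [Matrix.conjTranspose_mul, hNh, Matrix.mul_assoc, ← hT, h1]

/-- A contraction that detects the trace norm of `M`, bounded below through
`‖M‖₂³ ≤ ‖M‖₁ ‖M‖₄²`. -/
theorem exists_contraction_trace_ge [Fintype k] [Fintype l] [DecidableEq l] (M : Matrix k l ℂ) :
    ∃ U : Matrix k l ℂ, IsContraction U ∧ 0 ≤ (Uᴴ * M).trace.re ∧
      frobSq M ^ 3 ≤ (Uᴴ * M).trace.re ^ 2 * frobSq (Mᴴ * M) := by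
  obtain ⟨U, hU, hUM⟩ := exists_polar M
  have hM : (Mᴴ * M).PosSemidef := Matrix.posSemidef_conjTranspose_mul_self M
  set T := Mᴴ * M with hT
  have hpos := hM.eigenvalues_nonneg
  have hh := hM.isHermitian
  have h1 : (Uᴴ * M).trace.re = ∑ i, √(hh.eigenvalues i) := by
    rw [hUM, trace_cfc hh, Complex.ofReal_re]
  have h2 : frobSq M = ∑ i, hh.eigenvalues i := by
    have h := trace_cfc hh fun x => x
    rw [cfc_id' ℝ T] at h
    have h' := trace_conjTranspose_mul_self M
    rw [← hT, h] at h'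
    exact_mod_cast h'.symm
  have h4 : frobSq T = ∑ i, hh.eigenvalues i ^ 2 := by
    have h := trace_cfc hh fun x => x * x
    rw [cfc_mul_matrix, cfc_id' ℝ T] at h
    have h' := trace_conjTranspose_mul_self T
    rw [hh.eq, h] at h'
    simp only [← sq] at h'
    exact_mod_cast h'.symm
  refine ⟨U, hU, ?_, ?_⟩
  · rw [h1]
    exact Finset.sum_nonneg fun i _ => Real.sqrt_nonneg _
  rw [h1, h2, h4]
  set μ := hh.eigenvalues
  -- Cauchy–Schwarz twice, between the norms `1, 3` and `2, 4` of the singular values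
  have c1 := Finset.sum_mul_sq_le_sq_mul_sq Finset.univ
    (fun i => √(√(μ i))) fun i => √(√(μ i)) * √(μ i)
  have c2 := Finset.sum_mul_sq_le_sq_mul_sq Finset.univ (fun i => √(μ i)) fun i => μ i
  have e0 : ∀ i, √(μ i) * √(μ i) = μ i := fun i => Real.mul_self_sqrt (hpos i)
  have e1 : ∀ i, √(√(μ i)) * √(√(μ i)) = √(μ i) := fun i => Real.mul_self_sqrt (Real.sqrt_nonneg _)
  have e2 : ∀ i, √(√(μ i)) * (√(√(μ i)) * √(μ i)) = μ i := fun i => by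
    rw [← mul_assoc, e1, e0]
  have e3 : ∀ i, (√(√(μ i)) * √(μ i)) ^ 2 = √(μ i) * μ i := fun i => by
    rw [mul_pow, sq, sq, e1, e0]
  simp only [e2, e3, sq (√(√(μ _))), e1] at c1
  simp only [sq (√(μ _)), e0] at c2
  set S1 := ∑ i, √(μ i)
  set S2 := ∑ i, μ i
  set S3 := ∑ i, √(μ i) * μ i
  set S4 := ∑ i, μ i ^ 2
  have p1 : 0 ≤ S1 := Finset.sum_nonneg fun i _ => Real.sqrt_nonneg _
  have p2 : 0 ≤ S2 := Finset.sum_nonneg fun i _ => hpos i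
  have p3 : 0 ≤ S3 := Finset.sum_nonneg fun i _ => mul_nonneg (Real.sqrt_nonneg _) (hpos i)
  have p4 : 0 ≤ S4 := Finset.sum_nonneg fun i _ => sq_nonneg _
  rcases p2.eq_or_lt with hz | hz
  · rw [← hz]
    simpa using mul_nonneg (sq_nonneg S1) p4
  · have h5 : (S2 ^ 2) ^ 2 ≤ (S1 * S3) ^ 2 := pow_le_pow_left₀ (sq_nonneg _) c1 2
    have h6 : (S1 * S3) ^ 2 ≤ S1 ^ 2 * (S2 * S4) := by
      rw [mul_pow]
      exact mul_le_mul_of_nonneg_left c2 (sq_nonneg _)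
    have h7 : S2 * S2 ^ 3 ≤ S2 * (S1 ^ 2 * S4) := by nlinarith
    exact le_of_mul_le_mul_left h7 hz

end Frobenius

/-! ### Hölder's inequality for the Schatten norms -/

theorem schattenNorm_nonneg {m : ℕ} (q : ℝ≥0∞) {A : Matrix (Fin m) (Fin m) ℂ}
    (hA : A.IsHermitian) : 0 ≤ schattenNorm q hA := by
  unfold schattenNorm
  split_ifs
  · exact Real.iSup_nonneg fun i => abs_nonneg _
  · positivity

/-- Hölder's inequality for a weighted sum of eigenvalues with weights in `[0, 2]`. -/
theorem sum_mul_abs_eigenvalues_le {m : ℕ} {q : ℝ≥0∞} (hq : 1 ≤ q)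
    {A : Matrix (Fin m) (Fin m) ℂ} (hA : A.IsHermitian) {w : Fin m → ℝ} (hw0 : ∀ j, 0 ≤ w j)
    (hw2 : ∀ j, w j ≤ 2) {L : ℝ} (hL : ∑ j, w j ≤ L) :
    ∑ j, w j * |hA.eigenvalues j| ≤ 2 * schattenNorm q hA * L ^ (1 - (1 / q).toReal) := by
  have hs0 : 0 ≤ ∑ j, w j := Finset.sum_nonneg fun j _ => hw0 j
  have hn := schattenNorm_nonneg q hA
  by_cases hqt : q = ⊤
  · subst hqt
    have h1 : ∀ j, |hA.eigenvalues j| ≤ schattenNorm ⊤ hA := fun j => by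
      rw [schattenNorm, if_pos rfl]
      exact le_ciSup (f := fun i => |hA.eigenvalues i|) (Set.finite_range _).bddAbove j
    have h2 : ∑ j, w j * |hA.eigenvalues j| ≤ (∑ j, w j) * schattenNorm ⊤ hA := by
      rw [Finset.sum_mul]
      exact Finset.sum_le_sum fun j _ => mul_le_mul_of_nonneg_left (h1 j) (hw0 j)
    simp only [one_div, ENNReal.inv_top, ENNReal.toReal_zero, sub_zero, Real.rpow_one]
    nlinarith
  · set p := q.toReal with hp
    have hp1 : 1 ≤ p := by
      rw [hp, ← ENNReal.toReal_one]
      exact ENNReal.toReal_mono hqt hq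
    have hqp : (1 / q).toReal = p⁻¹ := by rw [one_div, ENNReal.toReal_inv]
    have hpi : p⁻¹ ≤ 1 := inv_le_one_of_one_le₀ hp1
    have hpi0 : 0 ≤ p⁻¹ := by positivity
    have h1 := Real.inner_le_weight_mul_Lp_of_nonneg Finset.univ hp1 w
      (fun j => |hA.eigenvalues j|) hw0 fun j => abs_nonneg _
    rw [hqp]
    have h2 : (∑ j, w j * |hA.eigenvalues j| ^ p) ^ p⁻¹ ≤ 2 * schattenNorm q hA := by
      have h3 : ∑ j, w j * |hA.eigenvalues j| ^ p ≤ 2 * ∑ j, |hA.eigenvalues j| ^ p := by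
        rw [Finset.mul_sum]
        exact Finset.sum_le_sum fun j _ => mul_le_mul_of_nonneg_right (hw2 j) (by positivity)
      have h4 : (2 : ℝ) ^ p⁻¹ ≤ 2 := by
        simpa using Real.rpow_le_rpow_of_exponent_le (by norm_num : (1 : ℝ) ≤ 2) hpi
      refine (Real.rpow_le_rpow (Finset.sum_nonneg fun j _ =>
        mul_nonneg (hw0 j) (by positivity)) h3 hpi0).trans ?_
      rw [Real.mul_rpow (by norm_num) (by positivity), schattenNorm, if_neg hqt, ← hp, one_div]
      exact mul_le_mul_of_nonneg_right h4 (by positivity)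
    refine h1.trans ?_
    rw [mul_comm]
    exact mul_le_mul h2 (Real.rpow_le_rpow hs0 hL (by linarith)) (by positivity) (by positivity)

theorem IsContraction.row_le {k l : Type*} [Fintype k] [Fintype l] [DecidableEq k] [DecidableEq l]
    {Y : Matrix k l ℂ} (hY : IsContraction Y) (i : k) : ∑ j, ‖Y i j‖ ^ 2 ≤ 1 := by
  have h := (hY.conjTranspose).diag_nonneg (i := i)
  rw [Matrix.conjTranspose_conjTranspose, Matrix.sub_apply, Matrix.one_apply_eq,
    Matrix.mul_apply] at h
  have h2 : ∑ j, Y i j * Yᴴ j i = ((∑ j, ‖Y i j‖ ^ 2 : ℝ) : ℂ) := by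
    push_cast
    exact Finset.sum_congr rfl fun j _ => RCLike.mul_conj (Y i j)
  rw [h2, ← Complex.ofReal_one, ← Complex.ofReal_sub, Complex.zero_le_real] at h
  linarith

theorem norm_diag_mul_conjTranspose_add_le {k l : Type*} [Fintype k] [Fintype l]
    (Y Z : Matrix k l ℂ) (i : k) :
    ‖(Y * Zᴴ + Z * Yᴴ) i i‖ ≤ ∑ j, (‖Y i j‖ ^ 2 + ‖Z i j‖ ^ 2) := by
  rw [Matrix.add_apply, Matrix.mul_apply, Matrix.mul_apply, ← Finset.sum_add_distrib]
  refine (norm_sum_le _ _).trans (Finset.sum_le_sum fun j _ => (norm_add_le _ _).trans ?_)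
  simp only [Matrix.conjTranspose_apply, norm_mul, norm_star]
  nlinarith [sq_nonneg (‖Y i j‖ - ‖Z i j‖)]

/-- Duality between the Schatten norms: testing against `Z Pᴴ + P Zᴴ` for `m × l` contractions
`Z`, `P`, a matrix of rank at most `2 l` and operator norm at most `2`. -/
theorem norm_trace_test_mul_le {m : ℕ} {l : Type*} [Fintype l] [DecidableEq l]
    {q : ℝ≥0∞} (hq : 1 ≤ q) {Z P : Matrix (Fin m) l ℂ} (hZ : IsContraction Z)
    (hP : IsContraction P) {A : Matrix (Fin m) (Fin m) ℂ} (hA : A.IsHermitian) :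
    ‖((Z * Pᴴ + P * Zᴴ) * A).trace‖ ≤
      2 * schattenNorm q hA * (2 * Fintype.card l : ℝ) ^ (1 - (1 / q).toReal) := by
  set Q : Matrix (Fin m) (Fin m) ℂ := hA.eigenvectorUnitary.1 with hQ
  have hQQ : Q * Qᴴ = 1 := Unitary.coe_mul_star_self hA.eigenvectorUnitary
  have hQi : IsContraction Qᴴ := isContraction_of_isometry (by
    rw [Matrix.conjTranspose_conjTranspose]; exact hQQ)
  -- `w j` bounds the diagonal entry of the test matrix at the `j`-th eigenvector of `A`
  set w : Fin m → ℝ := fun j => ∑ i, (‖(Qᴴ * Z) j i‖ ^ 2 + ‖(Qᴴ * P) j i‖ ^ 2) with hw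
  have hYZ := hQi.mul hZ
  have hYP := hQi.mul hP
  have htr : ((Z * Pᴴ + P * Zᴴ) * A).trace =
      ∑ j, ((Qᴴ * Z) * (Qᴴ * P)ᴴ + (Qᴴ * P) * (Qᴴ * Z)ᴴ) j j * (hA.eigenvalues j : ℂ) := by
    have h1 : (Qᴴ * Z) * (Qᴴ * P)ᴴ + (Qᴴ * P) * (Qᴴ * Z)ᴴ = Qᴴ * (Z * Pᴴ + P * Zᴴ) * Q := by
      simp only [Matrix.conjTranspose_mul, Matrix.conjTranspose_conjTranspose, Matrix.mul_add,
        Matrix.add_mul, Matrix.mul_assoc]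
    have h2 : A = Q * Matrix.diagonal (fun j => (hA.eigenvalues j : ℂ)) * Qᴴ := by
      conv_lhs => rw [hA.spectral_theorem, Unitary.conjStarAlgAut_apply]
      rfl
    rw [h1]
    conv_lhs => rw [h2, ← Matrix.mul_assoc, ← Matrix.mul_assoc, Matrix.trace_mul_comm,
      ← Matrix.mul_assoc, ← Matrix.mul_assoc]
    simp [Matrix.trace]
  rw [htr]
  refine (norm_sum_le _ _).trans ?_
  refine (Finset.sum_le_sum (g := fun j => w j * |hA.eigenvalues j|) fun j _ => ?_).trans
    (sum_mul_abs_eigenvalues_le hq hA (w := w) (fun j => by positivity) (fun j => ?_) ?_)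
  · rw [norm_mul, Complex.norm_real, Real.norm_eq_abs]
    exact mul_le_mul_of_nonneg_right (norm_diag_mul_conjTranspose_add_le _ _ j) (abs_nonneg _)
  · rw [hw]
    simp only [Finset.sum_add_distrib]
    linarith [hYZ.row_le j, hYP.row_le j]
  · have h1 := hYZ.frobSq_le
    have h2 := hYP.frobSq_le
    simp only [hw, Finset.sum_add_distrib]
    unfold frobSq at h1 h2
    linarith

/-! ### Bures distance and relative entropy -/

/-- Hellinger closeness of `S` to `ρ`: some contraction aligns the square roots up to `h`.
It is implied by a small Bures distance and by a small relative entropy. -/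
def IsNear {m : ℕ} (h : ℝ) (S ρ : DensityMatrix m) : Prop :=
  ∃ U : Matrix (Fin m) (Fin m) ℂ, IsContraction U ∧
    1 - h / 2 ≤ (Uᴴ * (cfc Real.sqrt ρ.1 * cfc Real.sqrt S.1)).trace.re

theorem cfc_sqrt_mul_self {m : ℕ} {A : Matrix (Fin m) (Fin m) ℂ} (hA : A.PosSemidef) :
    cfc Real.sqrt A * cfc Real.sqrt A = A := by
  have hsa : IsSelfAdjoint A := hA.isHermitian
  rw [← cfc_mul_matrix]
  conv_rhs => rw [← cfc_id' ℝ A]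
  refine cfc_congr fun x hx => ?_
  rw [hA.isHermitian.spectrum_real_eq_range_eigenvalues] at hx
  obtain ⟨i, rfl⟩ := hx
  exact Real.mul_self_sqrt (hA.eigenvalues_nonneg i)

theorem cfc_sqrt_conjTranspose {m : ℕ} (A : Matrix (Fin m) (Fin m) ℂ) :
    (cfc Real.sqrt A)ᴴ = cfc Real.sqrt A :=
  (cfc_predicate Real.sqrt A : IsSelfAdjoint _)

theorem frobSq_cfc_sqrt {m : ℕ} (S : DensityMatrix m) : frobSq (cfc Real.sqrt S.1) = 1 := by
  have h := trace_conjTranspose_mul_self (cfc Real.sqrt S.1)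
  rw [cfc_sqrt_conjTranspose, cfc_sqrt_mul_self S.2.1, S.2.2] at h
  exact_mod_cast h.symm

/-- A small Bures distance means closeness, with the polar factor of `√ρ √S` as the contraction. -/
theorem isNear_of_buresSq_lt {m : ℕ} {h : ℝ} {S ρ : DensityMatrix m} (hS : buresSq S ρ < h) :
    IsNear h S ρ := by
  obtain ⟨U, hU, hUM⟩ := exists_polar (cfc Real.sqrt ρ.1 * cfc Real.sqrt S.1)
  refine ⟨U, hU, ?_⟩
  have : (cfc Real.sqrt ρ.1 * cfc Real.sqrt S.1)ᴴ * (cfc Real.sqrt ρ.1 * cfc Real.sqrt S.1) =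
      cfc Real.sqrt S.1 * ρ.1 * cfc Real.sqrt S.1 := by
    rw [Matrix.conjTranspose_mul, cfc_sqrt_conjTranspose, cfc_sqrt_conjTranspose]
    conv_rhs => rw [← cfc_sqrt_mul_self ρ.2.1]
    simp only [Matrix.mul_assoc]
  rw [hUM, this]
  unfold buresSq at hS
  linarith

/-- The joint spectral distribution of two Hermitian matrices: `tr (f(A) g(B))` is a double sum
over the two spectra with nonnegative weights that do not depend on `f` and `g`. -/
theorem exists_hsInner_cfc_eq {m : ℕ} {A B : Matrix (Fin m) (Fin m) ℂ} (hA : A.IsHermitian)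
    (hB : B.IsHermitian) :
    ∃ w : Fin m → Fin m → ℝ, (∀ j k, 0 ≤ w j k) ∧ ∀ f g : ℝ → ℝ,
      hsInner (cfc f A) (cfc g B) =
        ∑ j, ∑ k, w j k * (f (hA.eigenvalues j) * g (hB.eigenvalues k)) := by
  set Q : Matrix (Fin m) (Fin m) ℂ := hA.eigenvectorUnitary.1
  set R : Matrix (Fin m) (Fin m) ℂ := hB.eigenvectorUnitary.1
  refine ⟨fun j k => ‖(Qᴴ * R) j k‖ ^ 2, fun j k => by positivity, fun f g => ?_⟩
  have h1 : cfc f A = Q * Matrix.diagonal (fun j => (f (hA.eigenvalues j) : ℂ)) * Qᴴ := by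
    rw [hA.cfc_eq, Matrix.IsHermitian.cfc, Unitary.conjStarAlgAut_apply]
    rfl
  have h2 : cfc g B = R * Matrix.diagonal (fun j => (g (hB.eigenvalues j) : ℂ)) * Rᴴ := by
    rw [hB.cfc_eq, Matrix.IsHermitian.cfc, Unitary.conjStarAlgAut_apply]
    rfl
  have h3 : (cfc f A * cfc g B).trace =
      (Matrix.diagonal (fun j => (f (hA.eigenvalues j) : ℂ)) * (Qᴴ * R) *
        (Matrix.diagonal (fun j => (g (hB.eigenvalues j) : ℂ)) * (Qᴴ * R)ᴴ)).trace := by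
    rw [h1, h2, Matrix.conjTranspose_mul, Matrix.conjTranspose_conjTranspose]
    simp only [Matrix.mul_assoc]
    rw [Matrix.trace_mul_comm Q]
    simp only [Matrix.mul_assoc]
  rw [hsInner, h3, Matrix.trace, Complex.re_sum]
  refine Finset.sum_congr rfl fun j _ => ?_
  rw [Matrix.diag_apply, Matrix.mul_apply, Complex.re_sum]
  refine Finset.sum_congr rfl fun k _ => ?_
  rw [Matrix.diagonal_mul, Matrix.diagonal_mul, Matrix.conjTranspose_apply]
  have h4 : (Qᴴ * R) j k * star ((Qᴴ * R) j k) = ((‖(Qᴴ * R) j k‖ ^ 2 : ℝ) : ℂ) := by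
    push_cast
    exact RCLike.mul_conj _
  have h5 : (f (hA.eigenvalues j) : ℂ) * (Qᴴ * R) j k *
      ((g (hB.eigenvalues k) : ℂ) * star ((Qᴴ * R) j k)) =
      ((‖(Qᴴ * R) j k‖ ^ 2 * (f (hA.eigenvalues j) * g (hB.eigenvalues k)) : ℝ) : ℂ) := by
    rw [Complex.ofReal_mul, ← h4]
    push_cast
    ring
  rw [h5, Complex.ofReal_re]

/-- The pointwise inequality behind `KL ≥ squared Hellinger`. -/
theorem two_mul_sub_sqrt_le {p s : ℝ} (hp : 0 ≤ p) (hs : 0 < s) :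
    2 * p - 2 * (√p * √s) ≤ p * Real.log p - p * Real.log s := by
  rcases hp.eq_or_lt with rfl | hp
  · simp
  have hps : 0 < √s / √p := div_pos (Real.sqrt_pos.2 hs) (Real.sqrt_pos.2 hp)
  have h1 := Real.log_le_sub_one_of_pos hps
  rw [Real.log_div (Real.sqrt_pos.2 hs).ne' (Real.sqrt_pos.2 hp).ne', Real.log_sqrt hs.le,
    Real.log_sqrt hp.le] at h1
  have h2 : p * (√s / √p) = √p * √s := by
    have h3 := Real.mul_self_sqrt hp.le
    have h4 := (Real.sqrt_pos.2 hp).ne'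
    field_simp
    rw [sq, h3]
  nlinarith [mul_le_mul_of_nonneg_left h1 hp.le]

/-- Relative entropy dominates `2 - 2 tr (√ρ √S)`; so a small one means closeness, with the identity
as the contraction. -/
theorem isNear_of_relEntropy_lt {m : ℕ} {h : ℝ} {S ρ : DensityMatrix m}
    (hS : relEntropy ρ S < (h : EReal)) : IsNear h S ρ := by
  unfold relEntropy at hS
  split_ifs at hS with hpd
  swap
  · exact absurd hS (not_lt.2 le_top)
  rw [EReal.coe_lt_coe_iff] at hS
  refine ⟨1, isContraction_of_isometry (by simp), ?_⟩
  rw [Matrix.conjTranspose_one, Matrix.one_mul]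
  change 1 - h / 2 ≤ hsInner (cfc Real.sqrt ρ.1) (cfc Real.sqrt S.1)
  have hρ : IsSelfAdjoint ρ.1 := ρ.2.1.isHermitian
  have hSs : IsSelfAdjoint S.1 := S.2.1.isHermitian
  obtain ⟨w, hw, hwe⟩ := exists_hsInner_cfc_eq ρ.2.1.isHermitian hpd.isHermitian
  have hone : cfc (fun _ : ℝ => (1 : ℝ)) S.1 = 1 := cfc_const_one ℝ S.1
  have hid : cfc (fun x : ℝ => x) ρ.1 = ρ.1 := cfc_id' ℝ ρ.1
  have h1 : hsInner ρ.1 (cfc Real.log ρ.1) = ∑ j, ∑ k, w j k *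
      (ρ.2.1.isHermitian.eigenvalues j * Real.log (ρ.2.1.isHermitian.eigenvalues j) * 1) := by
    rw [← hwe (fun x => x * Real.log x) fun _ => 1, hone, cfc_mul_matrix, hid]
    simp [hsInner]
  have h2 : hsInner ρ.1 (cfc Real.log S.1) = ∑ j, ∑ k, w j k *
      (ρ.2.1.isHermitian.eigenvalues j * Real.log (hpd.isHermitian.eigenvalues k)) := by
    rw [← hwe (fun x => x) Real.log, hid]
  have h3 : 1 = ∑ j, ∑ k, w j k * (ρ.2.1.isHermitian.eigenvalues j * 1) := by
    rw [← hwe (fun x => x) fun _ => 1, hone, hid]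
    simp [hsInner, ρ.2.2]
  have h4 := hwe Real.sqrt Real.sqrt
  have h5 : hsInner ρ.1 (cfc Real.log ρ.1 - cfc Real.log S.1) =
      hsInner ρ.1 (cfc Real.log ρ.1) - hsInner ρ.1 (cfc Real.log S.1) := by
    simp [hsInner, mul_sub]
  have h6 : 2 * (∑ j, ∑ k, w j k * (ρ.2.1.isHermitian.eigenvalues j * 1)) -
      2 * hsInner (cfc Real.sqrt ρ.1) (cfc Real.sqrt S.1) ≤
      hsInner ρ.1 (cfc Real.log ρ.1) - hsInner ρ.1 (cfc Real.log S.1) := by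
    rw [h1, h2, h4]
    simp only [Finset.mul_sum, ← Finset.sum_sub_distrib]
    refine Finset.sum_le_sum fun j _ => Finset.sum_le_sum fun k _ => ?_
    have := mul_le_mul_of_nonneg_left (two_mul_sub_sqrt_le (ρ.2.1.eigenvalues_nonneg j)
      (hpd.eigenvalues_pos k)) (hw j k)
    linarith
  rw [← h3] at h6
  linarith

/-- A state near `S` has, up to mass `h`, a square root within Frobenius distance `√h` of `√S`. -/
theorem IsNear.exists_root {m : ℕ} {h : ℝ} {S ρ : DensityMatrix m} (hn : IsNear h S ρ) :
    ∃ A : Matrix (Fin m) (Fin m) ℂ, frobSq (A - cfc Real.sqrt S.1) ≤ h ∧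
      (ρ.1 - Aᴴ * A).PosSemidef ∧ (ρ.1 - Aᴴ * A).trace.re ≤ h := by
  obtain ⟨U, hU, hUM⟩ := hn
  set R := cfc Real.sqrt S.1 with hR
  set T := cfc Real.sqrt ρ.1 with hT
  have hTT : T * T = ρ.1 := cfc_sqrt_mul_self ρ.2.1
  have hTh : Tᴴ = T := cfc_sqrt_conjTranspose ρ.1
  have hRh : Rᴴ = R := cfc_sqrt_conjTranspose S.1
  have hR1 : frobSq R = 1 := frobSq_cfc_sqrt S
  have hT1 : frobSq T = 1 := frobSq_cfc_sqrt ρ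
  set A := Uᴴ * T with hA
  have hA1 : frobSq A ≤ 1 := hT1 ▸ hU.conjTranspose.frobSq_mul_le T
  have hAR : 1 - h / 2 ≤ (A * R).trace.re := by rwa [hA, Matrix.mul_assoc]
  have hexp : frobSq (A - R) = frobSq A + frobSq R - 2 * (A * R).trace.re := by
    have e := trace_conjTranspose_mul_self (A - R)
    have e1 : (A - R)ᴴ * (A - R) = Aᴴ * A + Rᴴ * R - (R * A + (R * A)ᴴ) := by
      rw [Matrix.conjTranspose_sub, Matrix.conjTranspose_mul R A, hRh]
      simp only [Matrix.sub_mul, Matrix.mul_sub]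
      abel
    rw [e1, Matrix.trace_sub, Matrix.trace_add, Matrix.trace_add, trace_conjTranspose_mul_self,
      trace_conjTranspose_mul_self, Matrix.trace_conjTranspose, Matrix.trace_mul_comm R A] at e
    have := congrArg Complex.re e
    simp only [Complex.sub_re, Complex.add_re, Complex.ofReal_re, Complex.star_def,
      Complex.conj_re] at this
    linarith
  refine ⟨A, by linarith, ?_, ?_⟩
  · have : ρ.1 - Aᴴ * A = Tᴴ * (1 - U * Uᴴ) * T := by
      rw [hA, Matrix.conjTranspose_mul, Matrix.conjTranspose_conjTranspose, hTh, Matrix.mul_sub,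
        Matrix.mul_one, Matrix.sub_mul, hTT]
      simp only [Matrix.mul_assoc]
    rw [this]
    have h2 := hU.conjTranspose
    rw [IsContraction, Matrix.conjTranspose_conjTranspose] at h2
    exact h2.conjTranspose_mul_mul_same T
  · rw [Matrix.trace_sub, ρ.2.2, trace_conjTranspose_mul_self]
    simp only [Complex.sub_re, Complex.one_re, Complex.ofReal_re]
    linarith [frobSq_nonneg (A - R)]

/-- An observable of operator norm at most `2` has expectation at most twice the mass. -/
theorem abs_trace_mul_posSemidef_le {m : ℕ} {W : Matrix (Fin m) (Fin m) ℂ}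
    (hW2 : ∀ X : Matrix (Fin m) (Fin m) ℂ, frobSq (W * X) ≤ 4 * frobSq X)
    {X : Matrix (Fin m) (Fin m) ℂ} (hX : X.PosSemidef) : |(W * X).trace.re| ≤ 2 * X.trace.re := by
  set Y := cfc Real.sqrt X
  have hY : Y * Y = X := cfc_sqrt_mul_self hX
  have hYh : Yᴴ = Y := cfc_sqrt_conjTranspose X
  have h1 : (W * X).trace = (Yᴴ * (W * Y)).trace := by
    rw [Matrix.trace_mul_comm Yᴴ, hYh, Matrix.mul_assoc, hY]
  have h2 : X.trace.re = frobSq Y := by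
    have := trace_conjTranspose_mul_self Y
    rw [hYh, hY] at this
    rw [this, Complex.ofReal_re]
  rw [h1, h2]
  refine (Complex.abs_re_le_norm _).trans ((norm_trace_conjTranspose_mul_le _ _).trans ?_)
  have h3 : √(frobSq (W * Y)) ≤ 2 * √(frobSq Y) := by
    rw [Real.sqrt_le_left (by positivity), mul_pow, Real.sq_sqrt (frobSq_nonneg _)]
    linarith [hW2 Y]
  have h4 := Real.mul_self_sqrt (frobSq_nonneg Y)
  nlinarith [Real.sqrt_nonneg (frobSq Y)]

/-- Two states near the same `S` cannot be told apart by an observable `W` under which both have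
little mass. -/
theorem trace_test_le_of_isNear {m : ℕ} {h κ : ℝ} (hκ : 0 ≤ κ) {S ρ ρ' : DensityMatrix m}
    {W : Matrix (Fin m) (Fin m) ℂ} (hW : W.IsHermitian)
    (hW2 : ∀ X : Matrix (Fin m) (Fin m) ℂ, frobSq (W * X) ≤ 4 * frobSq X)
    (hρ : (W * ρ.1 * W).trace.re ≤ 4 * κ) (hρ' : (W * ρ'.1 * W).trace.re ≤ 4 * κ)
    (hn : IsNear h S ρ) (hn' : IsNear h S ρ') :
    (W * (ρ.1 - ρ'.1)).trace.re ≤ 4 * h + 8 * (√h * √κ) := by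
  obtain ⟨A, hA1, hA2, hA3⟩ := hn.exists_root
  obtain ⟨B, hB1, hB2, hB3⟩ := hn'.exists_root
  have hh : 0 ≤ h := (frobSq_nonneg _).trans hA1
  have hD : √(frobSq (A - B)) ≤ 2 * √h := by
    have h1 := frobSq_add_le (A - cfc Real.sqrt S.1) ((-1 : ℂ) • (B - cfc Real.sqrt S.1))
    rw [frobSq_smul] at h1
    have h2 : A - cfc Real.sqrt S.1 + (-1 : ℂ) • (B - cfc Real.sqrt S.1) = A - B := by
      rw [neg_one_smul]
      abel
    rw [h2, norm_neg, norm_one] at h1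
    rw [Real.sqrt_le_left (by positivity), mul_pow, Real.sq_sqrt hh]
    linarith
  have hmass : ∀ (τ C : Matrix (Fin m) (Fin m) ℂ), (τ - Cᴴ * C).PosSemidef →
      (W * τ * W).trace.re ≤ 4 * κ → √(frobSq (C * W)) ≤ 2 * √κ := fun τ C hC hτ => by
    rw [Real.sqrt_le_left (by positivity), mul_pow, Real.sq_sqrt hκ]
    have h1 := (hC.conjTranspose_mul_mul_same W).trace_nonneg
    have h2 : Wᴴ * (τ - Cᴴ * C) * W = W * τ * W - (C * W)ᴴ * (C * W) := by
      rw [Matrix.conjTranspose_mul, hW.eq]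
      simp only [Matrix.mul_sub, Matrix.sub_mul, Matrix.mul_assoc]
    rw [h2, Matrix.trace_sub, trace_conjTranspose_mul_self] at h1
    have h3 := (Complex.le_def.1 h1).1
    simp only [Complex.zero_re, Complex.sub_re, Complex.ofReal_re] at h3
    linarith
  have hmA := hmass _ A hA2 hρ
  have hmB := hmass _ B hB2 hρ'
  have hsplit : (W * (ρ.1 - ρ'.1)).trace = (W * (ρ.1 - Aᴴ * A)).trace -
      (W * (ρ'.1 - Bᴴ * B)).trace + ((A * W)ᴴ * (A - B)).trace +
        ((A - B)ᴴ * (B * W)).trace := by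
    rw [← Matrix.mul_assoc (A - B)ᴴ, Matrix.trace_mul_comm ((A - B)ᴴ * B), ← Matrix.trace_sub,
      ← Matrix.trace_add, ← Matrix.trace_add]
    congr 1
    rw [Matrix.conjTranspose_mul, hW.eq, Matrix.conjTranspose_sub]
    simp only [Matrix.mul_sub, Matrix.sub_mul, Matrix.mul_assoc]
    abel
  rw [hsplit]
  simp only [Complex.add_re, Complex.sub_re]
  have t1 := abs_le.1 (abs_trace_mul_posSemidef_le hW2 hA2)
  have t2 := abs_le.1 (abs_trace_mul_posSemidef_le hW2 hB2)
  have hs := Real.sqrt_nonneg h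
  have hk := Real.sqrt_nonneg κ
  have t3 := (Complex.re_le_norm _).trans (norm_trace_conjTranspose_mul_le (A * W) (A - B))
  have t4 := (Complex.re_le_norm _).trans (norm_trace_conjTranspose_mul_le (A - B) (B * W))
  have t5 := mul_le_mul hmA hD (Real.sqrt_nonneg _) (by positivity)
  have t6 := mul_le_mul hD hmB (Real.sqrt_nonneg _) (by positivity)
  linarith

/-! ### Random sign matrices -/

/-- The sign `±1` encoded by a bit. -/
def bitSign (b : Bool) : ℝ := if b then 1 else -1

theorem bitSign_not (b : Bool) : bitSign (!b) = -bitSign b := by cases b <;> simp [bitSign]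

theorem bitSign_mul_self (b : Bool) : bitSign b * bitSign b = 1 := by cases b <;> simp [bitSign]

/-- The `a × l` sign matrix encoded by a pattern of bits. -/
def signMat {a l : ℕ} (ε : Fin a × Fin l → Bool) : Matrix (Fin a) (Fin l) ℂ :=
  Matrix.of fun i k => (bitSign (ε (i, k)) : ℂ)

theorem frobSq_signMat_sub {a l : ℕ} (ε ε' : Fin a × Fin l → Bool) :
    frobSq (signMat ε - signMat ε') = 4 * hammingDist ε ε' := by
  have h : ∀ b b' : Bool, ‖((bitSign b : ℝ) : ℂ) - (bitSign b' : ℝ)‖ ^ 2 =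
      4 * if b ≠ b' then 1 else 0 := fun b b' => by
    rw [← Complex.ofReal_sub, Complex.norm_real]
    cases b <;> cases b' <;> norm_num [bitSign]
  rw [hammingDist, Finset.card_filter, frobSq, ← Finset.sum_product', Finset.univ_product_univ]
  push_cast
  rw [Finset.mul_sum]
  exact Finset.sum_congr rfl fun x _ => h _ _

theorem frobSq_mul_conjTranspose_self {k l : Type*} [Fintype k] [Fintype l] (X : Matrix k l ℂ) :
    frobSq (X * Xᴴ) = frobSq (Xᴴ * X) := by
  have h1 := trace_conjTranspose_mul_self (X * Xᴴ)
  have h2 := trace_conjTranspose_mul_self (Xᴴ * X)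
  have : (X * Xᴴ)ᴴ * (X * Xᴴ) = X * (Xᴴ * X * Xᴴ) := by
    simp only [Matrix.conjTranspose_mul, Matrix.conjTranspose_conjTranspose, Matrix.mul_assoc]
  rw [this, Matrix.trace_mul_comm] at h1
  have h3 : (Xᴴ * X)ᴴ * (Xᴴ * X) = Xᴴ * X * Xᴴ * X := by
    simp only [Matrix.conjTranspose_mul, Matrix.conjTranspose_conjTranspose, Matrix.mul_assoc]
  rw [h3, h1] at h2
  exact_mod_cast h2

theorem frobSq_conjTranspose_mul_le {k l p : Type*} [Fintype k] [Fintype l] [Fintype p]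
    (X : Matrix k l ℂ) (Y : Matrix k p ℂ) :
    frobSq (Xᴴ * Y) ≤ √(frobSq (Xᴴ * X)) * √(frobSq (Yᴴ * Y)) := by
  have h1 := trace_conjTranspose_mul_self (Xᴴ * Y)
  have h2 : (Xᴴ * Y)ᴴ * (Xᴴ * Y) = Yᴴ * (X * Xᴴ * Y) := by
    simp only [Matrix.conjTranspose_mul, Matrix.conjTranspose_conjTranspose, Matrix.mul_assoc]
  have h3 : X * Xᴴ * Y * Yᴴ = (X * Xᴴ)ᴴ * (Y * Yᴴ) := by
    simp only [Matrix.conjTranspose_mul, Matrix.conjTranspose_conjTranspose, Matrix.mul_assoc]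
  rw [h2, Matrix.trace_mul_comm, h3] at h1
  have h4 := norm_trace_conjTranspose_mul_le (X * Xᴴ) (Y * Yᴴ)
  rw [h1, Complex.norm_real, Real.norm_eq_abs, frobSq_mul_conjTranspose_self,
    frobSq_mul_conjTranspose_self] at h4
  exact (le_abs_self _).trans h4

/-- The triangle inequality for the Schatten 4-norm, with a worse constant. -/
theorem frobSq_gram_sub_le {k l : Type*} [Fintype k] [Fintype l] {X Y : Matrix k l ℂ} {e : ℝ}
    (hX : frobSq (Xᴴ * X) ≤ e) (hY : frobSq (Yᴴ * Y) ≤ e) :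
    frobSq ((X - Y)ᴴ * (X - Y)) ≤ 16 * e := by
  set D := X - Y with hD
  have h1 := frobSq_add_le (Dᴴ * X) ((-1 : ℂ) • (Dᴴ * Y))
  have h2 : Dᴴ * X + (-1 : ℂ) • (Dᴴ * Y) = Dᴴ * D := by
    conv_rhs => rw [hD, Matrix.mul_sub]
    rw [neg_one_smul, sub_eq_add_neg]
  rw [h2, frobSq_smul, norm_neg, norm_one] at h1
  have h3 := frobSq_conjTranspose_mul_le D X
  have h4 := frobSq_conjTranspose_mul_le D Y
  have h5 := Real.sqrt_le_sqrt hX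
  have h6 := Real.sqrt_le_sqrt hY
  have he : 0 ≤ e := (frobSq_nonneg _).trans hX
  set f := √(frobSq (Dᴴ * D)) with hf
  have hf0 : 0 ≤ f := Real.sqrt_nonneg _
  have hff : f * f = frobSq (Dᴴ * D) := Real.mul_self_sqrt (frobSq_nonneg _)
  have hee : √e * √e = e := Real.mul_self_sqrt he
  have h7 : f * f ≤ f * (4 * √e) := by
    have := mul_le_mul_of_nonneg_left h5 hf0
    have := mul_le_mul_of_nonneg_left h6 hf0
    linarith
  have h8 : f ≤ 4 * √e := by
    rcases hf0.eq_or_lt with h | h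
    · rw [← h]; positivity
    · exact le_of_mul_le_mul_left h7 h
  nlinarith [Real.sqrt_nonneg e]

/-- The fourth power of the Schatten 4-norm in terms of the inner products of columns. -/
theorem frobSq_gram_signMat {a l : ℕ} (ε : Fin a × Fin l → Bool) :
    frobSq ((signMat ε)ᴴ * signMat ε) =
      ∑ k, ∑ k', (∑ i, bitSign (ε (i, k)) * bitSign (ε (i, k'))) ^ 2 := by
  unfold frobSq
  refine Finset.sum_congr rfl fun k _ => Finset.sum_congr rfl fun k' _ => ?_
  have : ((signMat ε)ᴴ * signMat ε) k k' =
      ((∑ i, bitSign (ε (i, k)) * bitSign (ε (i, k')) : ℝ) : ℂ) := by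
    simp [Matrix.mul_apply, signMat]
  rw [this, Complex.norm_real, Real.norm_eq_abs, sq_abs]

/-- Columns of a random sign matrix are orthogonal in mean square. -/
theorem sum_sq_inner_columns {a l : ℕ} {k k' : Fin l} (h : k ≠ k') :
    ∑ ε : Fin a × Fin l → Bool, (∑ i, bitSign (ε (i, k)) * bitSign (ε (i, k'))) ^ 2 =
      2 ^ (a * l) * a := by
  have hcross : ∀ i j : Fin a, ∑ ε : Fin a × Fin l → Bool,
      bitSign (ε (i, k)) * bitSign (ε (i, k')) * (bitSign (ε (j, k)) * bitSign (ε (j, k'))) =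
        if i = j then 2 ^ (a * l) else 0 := by
    intro i j
    split_ifs with hij
    · subst hij
      have : ∀ ε : Fin a × Fin l → Bool, bitSign (ε (i, k)) * bitSign (ε (i, k')) *
          (bitSign (ε (i, k)) * bitSign (ε (i, k'))) = 1 := fun ε => by
        rw [mul_mul_mul_comm, bitSign_mul_self, bitSign_mul_self, one_mul]
      simp [this]
    · -- flipping the bit `(i, k)` changes the sign of the summand
      have hs := sum_flipBit (i, k) fun ε : Fin a × Fin l → Bool =>
        bitSign (ε (i, k)) * bitSign (ε (i, k')) * (bitSign (ε (j, k)) * bitSign (ε (j, k')))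
      have h1 : (i, k') ≠ (i, k) := fun e => h (Prod.ext_iff.1 e).2.symm
      have h2 : ∀ x, (j, x) ≠ (i, k) := fun x e => hij (Prod.ext_iff.1 e).1.symm
      simp only [flipBit_same, flipBit_of_ne _ h1, flipBit_of_ne _ (h2 _), bitSign_not, neg_mul,
        Finset.sum_neg_distrib] at hs
      linarith
  simp only [sq, Finset.sum_mul_sum]
  rw [Finset.sum_comm]
  have : ∀ i : Fin a, ∑ ε : Fin a × Fin l → Bool, ∑ j,
      bitSign (ε (i, k)) * bitSign (ε (i, k')) * (bitSign (ε (j, k)) * bitSign (ε (j, k'))) =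
        2 ^ (a * l) := fun i => by
    rw [Finset.sum_comm]
    simp [hcross]
  simp [this, mul_comm]

/-- The mean of the fourth power of the Schatten 4-norm. -/
theorem sum_frobSq_gram_signMat_le {a l : ℕ} (hla : l ≤ a) :
    ∑ ε : Fin a × Fin l → Bool, frobSq ((signMat ε)ᴴ * signMat ε) ≤
      2 ^ (a * l) * (2 * l * a ^ 2) := by
  simp only [frobSq_gram_signMat]
  rw [Finset.sum_comm]
  have hk : ∀ k : Fin l, ∑ ε : Fin a × Fin l → Bool,
      ∑ k', (∑ i, bitSign (ε (i, k)) * bitSign (ε (i, k'))) ^ 2 ≤ 2 ^ (a * l) * (2 * a ^ 2) := by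
    intro k
    rw [Finset.sum_comm, ← Finset.add_sum_erase _ _ (Finset.mem_univ k)]
    have h1 : ∑ ε : Fin a × Fin l → Bool,
        (∑ i, bitSign (ε (i, k)) * bitSign (ε (i, k))) ^ 2 = 2 ^ (a * l) * (a : ℝ) ^ 2 := by
      simp [bitSign_mul_self]
    have h2 : ∀ k' ∈ Finset.univ.erase k, ∑ ε : Fin a × Fin l → Bool,
        (∑ i, bitSign (ε (i, k)) * bitSign (ε (i, k'))) ^ 2 = 2 ^ (a * l) * a := fun k' hk' =>
      sum_sq_inner_columns (Finset.ne_of_mem_erase hk').symm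
    rw [h1, Finset.sum_congr rfl h2, Finset.sum_const, nsmul_eq_mul]
    have h3 : ((Finset.univ.erase k).card : ℝ) ≤ a := by
      have : (Finset.univ.erase k).card ≤ l := (Finset.card_erase_le).trans (by simp)
      exact_mod_cast this.trans hla
    have h4 : (0 : ℝ) ≤ 2 ^ (a * l) * a := by positivity
    nlinarith [mul_le_mul_of_nonneg_right h3 h4]
  refine (Finset.sum_le_sum fun k _ => hk k).trans (le_of_eq ?_)
  simp
  ring

/-- The sign patterns whose matrix has a Schatten 4-norm of typical size. The constant `256` is `128`
times the one in the mean, so that by Markov's inequality a share of at most `1 / 128` is left out. -/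
def goodSigns (a l : ℕ) : Finset (Fin a × Fin l → Bool) :=
  {ε | frobSq ((signMat ε)ᴴ * signMat ε) ≤ 256 * l * a ^ 2}

theorem card_goodSigns_compl_le {a l : ℕ} (hl : 1 ≤ l) (hla : l ≤ a) :
    ((goodSigns a l)ᶜ.card : ℝ) ≤ 1 / 8 / 16 * 2 ^ Fintype.card (Fin a × Fin l) := by
  have hl' : (0 : ℝ) < l := by exact_mod_cast hl
  have ha' : (0 : ℝ) < a := by exact_mod_cast lt_of_lt_of_le hl hla
  have h1 : ((goodSigns a l)ᶜ.card : ℝ) * (256 * l * a ^ 2) ≤ 2 ^ (a * l) * (2 * l * a ^ 2) := by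
    refine le_trans ?_ (sum_frobSq_gram_signMat_le hla)
    rw [← nsmul_eq_mul, ← Finset.sum_const]
    refine (Finset.sum_le_sum fun ε hε => ?_).trans
      (Finset.sum_le_sum_of_subset_of_nonneg (Finset.subset_univ _)
        fun ε _ _ => frobSq_nonneg _)
    simp only [goodSigns, Finset.mem_compl, Finset.mem_filter_univ, not_le] at hε
    exact hε.le
  have h2 : (0 : ℝ) < 2 * l * a ^ 2 := by positivity
  simp only [Fintype.card_prod, Fintype.card_fin]
  refine le_of_mul_le_mul_right ?_ h2
  linarith

/-- Two typical sign matrices that differ in a fixed share of their entries are far apart in trace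
norm. -/
theorem exists_contraction_signMat {a l : ℕ} (hl : 1 ≤ l) (hla : l ≤ a)
    {ε ε' : Fin a × Fin l → Bool} (hε : ε ∈ goodSigns a l) (hε' : ε' ∈ goodSigns a l)
    (hd : 1 / 8 / 8 * (Fintype.card (Fin a × Fin l) : ℝ) < hammingDist ε ε') :
    ∃ U : Matrix (Fin a) (Fin l) ℂ, IsContraction U ∧
      l * √a / 4096 ≤ (Uᴴ * (signMat ε - signMat ε')).trace.re := by
  simp only [goodSigns, Finset.mem_filter_univ] at hε hε'
  obtain ⟨U, hU, h0, h1⟩ := exists_contraction_trace_ge (signMat ε - signMat ε')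
  refine ⟨U, hU, ?_⟩
  have h2 := frobSq_gram_sub_le hε hε'
  rw [frobSq_signMat_sub] at h1
  simp only [Fintype.card_prod, Fintype.card_fin, Nat.cast_mul] at hd
  have hl' : (0 : ℝ) < l := by exact_mod_cast hl
  have ha' : (0 : ℝ) < a := by exact_mod_cast lt_of_lt_of_le hl hla
  set T := (Uᴴ * (signMat ε - signMat ε')).trace.re
  have h3 : (l * a / 16 : ℝ) ^ 3 ≤ T ^ 2 * (16 * (256 * l * a ^ 2)) := by
    refine le_trans (pow_le_pow_left₀ (by positivity) ?_ 3)
      (h1.trans (mul_le_mul_of_nonneg_left h2 (sq_nonneg _)))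
    linarith
  refine abs_le_of_sq_le_sq' ?_ h0 |>.2
  rw [div_pow, mul_pow, Real.sq_sqrt ha'.le]
  have h4 : (0 : ℝ) < 4096 * l * a ^ 2 := by positivity
  refine le_of_mul_le_mul_right ?_ h4
  nlinarith

/-! ### The hypotheses -/

/-- Isometries `P` of `ℂˡ` and `V` of `ℂᵃ` into `ℂᵐ` with orthogonal ranges, and a unit vector `o`,
written as an `m × 1` matrix. No relation between `o` and the two ranges is required. -/
structure Frame (m l a : ℕ) where
  P : Matrix (Fin m) (Fin l) ℂ
  V : Matrix (Fin m) (Fin a) ℂ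
  o : Matrix (Fin m) (Fin 1) ℂ
  hP : Pᴴ * P = 1
  hV : Vᴴ * V = 1
  hPV : Pᴴ * V = 0
  ho : oᴴ * o = 1

/-- The parameters `(s, t, β)` of the family: `β` is the mass of the base state, `t` the mass of each
of the `l` perturbed directions, `s` the size of the perturbation relative to that mass. -/
structure Weights (l : ℕ) where
  s : ℝ
  t : ℝ
  β : ℝ
  hs0 : 0 ≤ s
  hs1 : s ≤ 1
  ht : 0 ≤ t
  hβ : 0 ≤ β
  hsum : l * t + β = 1

namespace Frame

variable {m l a : ℕ} (F : Frame m l a)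

theorem hVP : F.Vᴴ * F.P = 0 := by
  have := congrArg Matrix.conjTranspose F.hPV
  simpa using this

/-- The factor `P + (s / √a) V Y` of the perturbed part of a state. -/
def root (s : ℝ) (Y : Matrix (Fin a) (Fin l) ℂ) : Matrix (Fin m) (Fin l) ℂ :=
  F.P + ((s / √a : ℝ) : ℂ) • (F.V * Y)

theorem conjTranspose_P_mul_root (s : ℝ) (Y : Matrix (Fin a) (Fin l) ℂ) :
    F.Pᴴ * F.root s Y = 1 := by
  rw [root, Matrix.mul_add, F.hP, Matrix.mul_smul, ← Matrix.mul_assoc, F.hPV, Matrix.zero_mul,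
    smul_zero, add_zero]

theorem conjTranspose_V_mul_root (s : ℝ) (Y : Matrix (Fin a) (Fin l) ℂ) :
    F.Vᴴ * F.root s Y = ((s / √a : ℝ) : ℂ) • Y := by
  rw [root, Matrix.mul_add, F.hVP, Matrix.mul_smul, ← Matrix.mul_assoc, F.hV, Matrix.one_mul,
    zero_add]

theorem root_gram (s : ℝ) (Y : Matrix (Fin a) (Fin l) ℂ) :
    (F.root s Y)ᴴ * F.root s Y = 1 + ((s ^ 2 / a : ℝ) : ℂ) • (Yᴴ * Y) := by
  have h : ((s / √a : ℝ) : ℂ) * ((s / √a : ℝ) : ℂ) = ((s ^ 2 / a : ℝ) : ℂ) := by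
    rw [← Complex.ofReal_mul, div_mul_div_comm, Real.mul_self_sqrt (Nat.cast_nonneg a), sq]
  conv_lhs => rw [root, Matrix.conjTranspose_add, Matrix.add_mul, ← root,
    conjTranspose_P_mul_root, Matrix.conjTranspose_smul, Matrix.conjTranspose_mul,
    Matrix.smul_mul, Matrix.mul_assoc, conjTranspose_V_mul_root, Matrix.mul_smul, smul_smul,
    Complex.star_def, Complex.conj_ofReal, h]

theorem root_gram_signMat_diag (ha : 0 < a) (s : ℝ) (ε : Fin a × Fin l → Bool) (k : Fin l) :
    ((F.root s (signMat ε))ᴴ * F.root s (signMat ε)) k k = ((1 + s ^ 2 : ℝ) : ℂ) := by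
  have h1 : ((signMat ε)ᴴ * signMat ε) k k = (a : ℂ) := by
    have : ∀ i, ((bitSign (ε (i, k)) : ℝ) : ℂ) * (bitSign (ε (i, k)) : ℝ) = 1 := fun i => by
      rw [← Complex.ofReal_mul, bitSign_mul_self, Complex.ofReal_one]
    simp [Matrix.mul_apply, signMat, this]
  have ha' : (a : ℂ) ≠ 0 := by exact_mod_cast ha.ne'
  rw [root_gram, Matrix.add_apply, Matrix.one_apply_eq, Matrix.smul_apply, h1]
  push_cast
  rw [smul_eq_mul, div_mul_cancel₀ _ ha']

theorem frobSq_root (ha : 0 < a) (s : ℝ) (ε : Fin a × Fin l → Bool) :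
    frobSq (F.root s (signMat ε)) = l * (1 + s ^ 2) := by
  have h := trace_conjTranspose_mul_self (F.root s (signMat ε))
  rw [Matrix.trace] at h
  simp only [Matrix.diag_apply, F.root_gram_signMat_diag ha, Finset.sum_const, Finset.card_univ,
    Fintype.card_fin, nsmul_eq_mul] at h
  exact_mod_cast h.symm

theorem trace_root_mul (ha : 0 < a) (s : ℝ) (ε : Fin a × Fin l → Bool) :
    (F.root s (signMat ε) * (F.root s (signMat ε))ᴴ).trace = ((l * (1 + s ^ 2) : ℝ) : ℂ) := by
  rw [Matrix.trace_mul_comm, trace_conjTranspose_mul_self, F.frobSq_root ha]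

/-- The density matrix of a sign pattern: a base state plus a multiple of `B Bᴴ`, where `B` is a
perturbation of an isometry by the sign matrix. The signs sit, to first order, in the off-diagonal
block of `B Bᴴ`, and the trace does not depend on them. -/
def state (w : Weights l) (ha : 0 < a) (ε : Fin a × Fin l → Bool) : DensityMatrix m :=
  ⟨(w.β : ℂ) • (F.o * F.oᴴ) + ((w.t / (1 + w.s ^ 2) : ℝ) : ℂ) •
    (F.root w.s (signMat ε) * (F.root w.s (signMat ε))ᴴ), by
    refine ⟨Matrix.PosSemidef.add ?_ ?_, ?_⟩
    · exact (Matrix.posSemidef_self_mul_conjTranspose _).smul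
        (Complex.zero_le_real.2 w.hβ)
    · exact (Matrix.posSemidef_self_mul_conjTranspose _).smul
        (Complex.zero_le_real.2 (div_nonneg w.ht (by positivity)))
    · have h1 : (F.o * F.oᴴ).trace = 1 := by
        rw [Matrix.trace_mul_comm, F.ho, Matrix.trace_one, Fintype.card_fin, Nat.cast_one]
      rw [Matrix.trace_add, Matrix.trace_smul, Matrix.trace_smul, h1, F.trace_root_mul ha,
        smul_eq_mul, smul_eq_mul, mul_one, ← Complex.ofReal_mul, ← Complex.ofReal_add,
        ← Complex.ofReal_one]
      congr 1
      have h2 : w.t / (1 + w.s ^ 2) * (l * (1 + w.s ^ 2)) = l * w.t := by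
        have : (1 + w.s ^ 2) ≠ 0 := by positivity
        field_simp
      rw [h2, add_comm]
      exact w.hsum⟩

theorem state_rank_le (w : Weights l) (ha : 0 < a) (ε : Fin a × Fin l → Bool) :
    (F.state w ha ε).1.rank ≤ l + 1 := by
  simp only [state]
  rw [← Matrix.smul_mul, ← Matrix.smul_mul, ← Matrix.fromCols_mul_fromRows]
  refine (Matrix.rank_mul_le_left _ _).trans ((Matrix.rank_le_card_width _).trans (le_of_eq ?_))
  simp [add_comm]

theorem state_rank_le_of_base_eq_zero (w : Weights l) (hw : w.β = 0) (ha : 0 < a)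
    (ε : Fin a × Fin l → Bool) : (F.state w ha ε).1.rank ≤ l := by
  simp only [state, hw, Complex.ofReal_zero, zero_smul, zero_add]
  rw [← Matrix.smul_mul]
  refine (Matrix.rank_mul_le_left _ _).trans ((Matrix.rank_le_card_width _).trans (le_of_eq ?_))
  simp

theorem state_sub (w : Weights l) (ha : 0 < a) (ε ε' : Fin a × Fin l → Bool) :
    (F.state w ha ε).1 - (F.state w ha ε').1 = ((w.t / (1 + w.s ^ 2) : ℝ) : ℂ) •
      (F.root w.s (signMat ε) * (F.root w.s (signMat ε))ᴴ -
        F.root w.s (signMat ε') * (F.root w.s (signMat ε'))ᴴ) := by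
  simp only [state]
  rw [add_sub_add_left_eq_sub, smul_sub]

theorem hsInner_self {D : Matrix (Fin m) (Fin m) ℂ} (hD : D.IsHermitian) :
    hsInner D D = frobSq D := by
  have h := trace_conjTranspose_mul_self D
  rw [hD.eq] at h
  rw [hsInner, h, Complex.ofReal_re]

theorem frobSq_single_mul {k p q : Type*} [Fintype k] [Fintype p] [Fintype q] [DecidableEq k]
    [DecidableEq p] (i : k) (j : p) (c : ℂ) (X : Matrix p q ℂ) :
    frobSq (Matrix.single i j c * X) = ‖c‖ ^ 2 * ∑ y, ‖X j y‖ ^ 2 := by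
  unfold frobSq
  rw [Finset.sum_eq_single i]
  · simp [mul_pow, Finset.mul_sum]
  · intro i' _ hi'
    simp [hi']
  · simp

theorem signMat_sub_flipBit (ε : Fin a × Fin l → Bool) (b : Fin a × Fin l) :
    signMat ε - signMat (flipBit ε b) = Matrix.single b.1 b.2 ((2 * bitSign (ε b) : ℝ) : ℂ) := by
  ext i k
  by_cases h : (i, k) = b
  · subst h
    simp [signMat, bitSign_not]
    ring
  · have h' : ¬(b.1 = i ∧ b.2 = k) := fun ⟨h1, h2⟩ => h (by rw [← h1, ← h2])
    rw [Matrix.single_apply, if_neg h']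
    simp [signMat, flipBit_of_ne _ h]

/-- Flipping one sign moves the state by `O(t s / √a)` in Hilbert–Schmidt norm. -/
theorem state_flipBit_close (w : Weights l) (ha : 0 < a) (ε : Fin a × Fin l → Bool)
    (b : Fin a × Fin l) :
    hsInner ((F.state w ha ε).1 - (F.state w ha (flipBit ε b)).1)
      ((F.state w ha ε).1 - (F.state w ha (flipBit ε b)).1) ≤ 16 * (w.t * w.s) ^ 2 / a := by
  rw [hsInner_self ((F.state w ha ε).2.1.isHermitian.sub
    (F.state w ha (flipBit ε b)).2.1.isHermitian), F.state_sub, frobSq_smul, Complex.norm_real,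
    Real.norm_eq_abs, sq_abs]
  have ha' : (0 : ℝ) < a := by exact_mod_cast ha
  set B := F.root w.s (signMat ε) with hB
  set B' := F.root w.s (signMat (flipBit ε b)) with hB'
  set D := Matrix.single b.1 b.2 ((2 * bitSign (ε b) : ℝ) : ℂ) with hD
  have hBB : B - B' = ((w.s / √a : ℝ) : ℂ) • (F.V * D) := by
    rw [hB, hB', root, root, add_sub_add_left_eq_sub, ← smul_sub, ← Matrix.mul_sub,
      signMat_sub_flipBit]
  have hrow : ∀ δ : Fin a × Fin l → Bool,
      ∑ y, ‖(F.root w.s (signMat δ))ᴴ b.2 y‖ ^ 2 = 1 + w.s ^ 2 := fun δ => by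
    have h := F.root_gram_signMat_diag ha w.s δ b.2
    have h2 : ((F.root w.s (signMat δ))ᴴ * F.root w.s (signMat δ)) b.2 b.2 =
        ((∑ y, ‖(F.root w.s (signMat δ))ᴴ b.2 y‖ ^ 2 : ℝ) : ℂ) := by
      rw [Matrix.mul_apply]
      push_cast
      refine Finset.sum_congr rfl fun y _ => ?_
      rw [Matrix.conjTranspose_apply, norm_star]
      exact RCLike.conj_mul _
    rw [h2] at h
    exact_mod_cast h
  have hone : ∀ δ : Fin a × Fin l → Bool,
      frobSq ((B - B') * (F.root w.s (signMat δ))ᴴ) = w.s ^ 2 / a * (4 * (1 + w.s ^ 2)) := by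
    intro δ
    have hsg : (2 * bitSign (ε b)) ^ 2 = 4 := by
      have := bitSign_mul_self (ε b)
      nlinarith
    rw [hBB, Matrix.smul_mul, frobSq_smul, Matrix.mul_assoc, frobSq_mul_of_isometry F.hV,
      frobSq_single_mul, hrow, Complex.norm_real, Complex.norm_real, Real.norm_eq_abs,
      Real.norm_eq_abs, sq_abs, sq_abs, hsg, div_pow, Real.sq_sqrt ha'.le]
  have hsplit : B * Bᴴ - B' * B'ᴴ = (B - B') * Bᴴ + ((B - B') * B'ᴴ)ᴴ := by
    rw [Matrix.conjTranspose_mul, Matrix.conjTranspose_conjTranspose, Matrix.conjTranspose_sub,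
      Matrix.sub_mul, Matrix.mul_sub]
    abel
  have h1 := frobSq_add_le ((B - B') * Bᴴ) ((B - B') * B'ᴴ)ᴴ
  rw [← hsplit, frobSq_conjTranspose, hone, hone] at h1
  refine (mul_le_mul_of_nonneg_left h1 (sq_nonneg _)).trans ?_
  have h3 : (w.t / (1 + w.s ^ 2)) ^ 2 * (2 * (w.s ^ 2 / a * (4 * (1 + w.s ^ 2))) +
      2 * (w.s ^ 2 / a * (4 * (1 + w.s ^ 2)))) =
        16 * (w.t * w.s) ^ 2 / a * (1 / (1 + w.s ^ 2)) := by
    have : (1 + w.s ^ 2) ≠ 0 := by positivity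
    field_simp
    ring
  rw [h3]
  refine mul_le_of_le_one_right (by positivity) ?_
  rw [div_le_one (by positivity)]
  nlinarith [sq_nonneg w.s]

/-- The off-diagonal observable `V U Pᴴ + P Uᴴ Vᴴ`. -/
def test (U : Matrix (Fin a) (Fin l) ℂ) : Matrix (Fin m) (Fin m) ℂ :=
  (F.V * U) * F.Pᴴ + F.P * (F.V * U)ᴴ

theorem test_isHermitian (U : Matrix (Fin a) (Fin l) ℂ) : (F.test U).IsHermitian := by
  simp only [Matrix.IsHermitian, test, Matrix.conjTranspose_add, Matrix.conjTranspose_mul,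
    Matrix.conjTranspose_conjTranspose]
  rw [add_comm]

theorem isContraction_P : IsContraction F.P := isContraction_of_isometry F.hP

theorem isContraction_V_mul {U : Matrix (Fin a) (Fin l) ℂ} (hU : IsContraction U) :
    IsContraction (F.V * U) := (isContraction_of_isometry F.hV).mul hU

theorem frobSq_test_mul_le {U : Matrix (Fin a) (Fin l) ℂ} (hU : IsContraction U) {p : ℕ}
    (X : Matrix (Fin m) (Fin p) ℂ) : frobSq (F.test U * X) ≤ 4 * frobSq X := by
  have hZ := F.isContraction_V_mul hU
  rw [test, Matrix.add_mul, Matrix.mul_assoc, Matrix.mul_assoc F.P]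
  have h1 := hZ.frobSq_mul_le (F.Pᴴ * X)
  have h2 := F.isContraction_P.conjTranspose.frobSq_mul_le X
  have h3 := F.isContraction_P.frobSq_mul_le ((F.V * U)ᴴ * X)
  have h4 := hZ.conjTranspose.frobSq_mul_le X
  linarith [frobSq_add_le (F.V * U * (F.Pᴴ * X)) (F.P * ((F.V * U)ᴴ * X))]

/-- The observable sees only the off-diagonal block, which is linear in `Y`. -/
theorem trace_test_mul_root (U Y : Matrix (Fin a) (Fin l) ℂ) (s : ℝ) :
    (F.test U * (F.root s Y * (F.root s Y)ᴴ)).trace.re = 2 * (s / √a) * (Uᴴ * Y).trace.re := by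
  set B := F.root s Y with hB
  have h1 : F.Pᴴ * B = 1 := F.conjTranspose_P_mul_root s Y
  have h1' : Bᴴ * F.P = 1 := by
    have := congrArg Matrix.conjTranspose h1
    simpa using this
  have h2 : (F.V * U)ᴴ * B = ((s / √a : ℝ) : ℂ) • (Uᴴ * Y) := by
    rw [Matrix.conjTranspose_mul, Matrix.mul_assoc, F.conjTranspose_V_mul_root, Matrix.mul_smul]
  have h2' : Bᴴ * (F.V * U) = (((s / √a : ℝ) : ℂ) • (Uᴴ * Y))ᴴ := by
    rw [← h2, Matrix.conjTranspose_mul, Matrix.conjTranspose_conjTranspose]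
  have h3 : (F.test U * (B * Bᴴ)).trace =
      ((((s / √a : ℝ) : ℂ) • (Uᴴ * Y))ᴴ).trace + (((s / √a : ℝ) : ℂ) • (Uᴴ * Y)).trace := by
    rw [← Matrix.mul_assoc, Matrix.trace_mul_comm, test, Matrix.add_mul, Matrix.mul_add,
      Matrix.mul_assoc (F.V * U), h1, Matrix.mul_one, h2', Matrix.mul_assoc F.P, h2,
      ← Matrix.mul_assoc, h1', Matrix.one_mul, Matrix.trace_add]
  rw [h3, Matrix.trace_conjTranspose, Complex.add_re, Complex.star_def, Complex.conj_re,
    Matrix.trace_smul, smul_eq_mul, Complex.re_ofReal_mul]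
  ring

/-- The observable separates two states whose sign matrices are far apart in trace norm. -/
theorem trace_test_state_sub (w : Weights l) (ha : 0 < a) (ε ε' : Fin a × Fin l → Bool)
    {U : Matrix (Fin a) (Fin l) ℂ}
    (hUε : l * √a / 4096 ≤ (Uᴴ * (signMat ε - signMat ε')).trace.re) :
    w.t * w.s * l / 4096 ≤
      (F.test U * ((F.state w ha ε).1 - (F.state w ha ε').1)).trace.re := by
  have ha' : 0 < √(a : ℝ) := Real.sqrt_pos.2 (by exact_mod_cast ha)
  rw [F.state_sub, Matrix.mul_smul, Matrix.trace_smul, smul_eq_mul, Complex.re_ofReal_mul,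
    Matrix.mul_sub, Matrix.trace_sub, Complex.sub_re, F.trace_test_mul_root,
    F.trace_test_mul_root, ← mul_sub, ← Complex.sub_re, ← Matrix.trace_sub, ← Matrix.mul_sub]
  have h1 : w.t / 2 ≤ w.t / (1 + w.s ^ 2) :=
    div_le_div_of_nonneg_left w.ht (by positivity) (by nlinarith [w.hs0, w.hs1])
  have h2 : 0 ≤ 2 * (w.s / √a) * (l * √a / 4096) := by
    have := w.hs0
    positivity
  calc w.t * w.s * l / 4096 = w.t / 2 * (2 * (w.s / √a) * (l * √a / 4096)) := by
        field_simp
    _ ≤ w.t / (1 + w.s ^ 2) * (2 * (w.s / √a) * (l * √a / 4096)) :=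
        mul_le_mul_of_nonneg_right h1 h2
    _ ≤ _ := mul_le_mul_of_nonneg_left
        (mul_le_mul_of_nonneg_left hUε (by have := w.hs0; positivity))
        (div_nonneg w.ht (by positivity))

/-- Away from the base state, the states have mass of order `l t`. -/
theorem trace_test_state_test_le (w : Weights l) (ha : 0 < a) (hPo : F.Pᴴ * F.o = 0)
    (hVo : F.Vᴴ * F.o = 0) (ε : Fin a × Fin l → Bool) {U : Matrix (Fin a) (Fin l) ℂ}
    (hU : IsContraction U) :
    (F.test U * (F.state w ha ε).1 * F.test U).trace.re ≤ 4 * (l * w.t) := by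
  have h1 : F.test U * F.o = 0 := by
    rw [test, Matrix.add_mul, Matrix.mul_assoc, hPo, Matrix.mul_zero, Matrix.mul_assoc,
      Matrix.conjTranspose_mul, Matrix.mul_assoc, hVo, Matrix.mul_zero, Matrix.mul_zero, add_zero]
  set B := F.root w.s (signMat ε) with hB
  have h2 : F.test U * (F.state w ha ε).1 * F.test U = ((w.t / (1 + w.s ^ 2) : ℝ) : ℂ) •
      ((F.test U * B) * (F.test U * B)ᴴ) := by
    simp only [state]
    rw [Matrix.mul_add, Matrix.mul_smul, ← Matrix.mul_assoc, h1, Matrix.zero_mul, smul_zero,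
      zero_add, Matrix.mul_smul, Matrix.smul_mul, ← hB, Matrix.conjTranspose_mul,
      (F.test_isHermitian U).eq]
    simp only [Matrix.mul_assoc]
  rw [h2, Matrix.trace_smul, smul_eq_mul, Complex.re_ofReal_mul, Matrix.trace_mul_comm,
    trace_conjTranspose_mul_self, Complex.ofReal_re]
  have h3 := F.frobSq_test_mul_le hU B
  rw [hB, F.frobSq_root ha] at h3
  refine (mul_le_mul_of_nonneg_left h3 (div_nonneg w.ht (by positivity))).trans (le_of_eq ?_)
  have : (1 + w.s ^ 2) ≠ 0 := by positivity
  field_simp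

end Frame

/-- The matrix whose columns are the standard basis vectors picked by `f`. -/
def colMat {m l : ℕ} (f : Fin l → Fin m) : Matrix (Fin m) (Fin l) ℂ :=
  Matrix.of fun x k => if x = f k then 1 else 0

theorem colMat_conjTranspose_mul {m l a : ℕ} (f : Fin l → Fin m) (g : Fin a → Fin m) :
    (colMat f)ᴴ * colMat g = Matrix.of fun i j => if f i = g j then 1 else 0 := by
  ext i j
  simp [Matrix.mul_apply, colMat, apply_ite, eq_comm]

theorem colMat_isometry {m l : ℕ} {f : Fin l → Fin m} (hf : Function.Injective f) :
    (colMat f)ᴴ * colMat f = 1 := by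
  rw [colMat_conjTranspose_mul]
  ext i j
  simp [Matrix.one_apply, hf.eq_iff]

theorem colMat_orthogonal {m l a : ℕ} {f : Fin l → Fin m} {g : Fin a → Fin m}
    (h : ∀ i j, f i ≠ g j) : (colMat f)ᴴ * colMat g = 0 := by
  rw [colMat_conjTranspose_mul]
  ext i j
  simp [h]

/-- The index block `c, c + 1, …, c + p - 1`. -/
def blockIdx {m p : ℕ} (c : ℕ) (h : c + p ≤ m) (i : Fin p) : Fin m := ⟨c + i, by omega⟩

theorem blockIdx_injective {m p : ℕ} (c : ℕ) (h : c + p ≤ m) :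
    Function.Injective (blockIdx c h) := fun i j hij => by
  have := Fin.mk.inj_iff.1 hij
  exact Fin.ext (by omega)

theorem blockIdx_ne {m p p' c c' : ℕ} (h : c + p ≤ m) (h' : c' + p' ≤ m) (hc : c + p ≤ c')
    (i : Fin p) (j : Fin p') : blockIdx c h i ≠ blockIdx c' h' j := fun hij => by
  have := Fin.mk.inj_iff.1 hij
  omega

/-- There is room in `ℂᵐ` for `l` directions and at least `m / 3` further ones; for `m ≥ 3` also for
an orthogonal base vector. -/
theorem exists_frame {m l : ℕ} (hm : 2 ≤ m) (hlm : l ≤ max 1 ((m - 1) / 2)) :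
    ∃ (a : ℕ) (F : Frame m l a), l ≤ a ∧ 0 < a ∧ m ≤ 3 * a ∧
      (3 ≤ m → F.Pᴴ * F.o = 0 ∧ F.Vᴴ * F.o = 0) := by
  rcases Nat.lt_or_ge m 3 with h3 | h3
  · have hl : l ≤ 1 := by omega
    have h0 : 0 + l ≤ m := by omega
    have h1 : 1 + 1 ≤ m := by omega
    have h2 : 0 + 1 ≤ m := by omega
    exact ⟨1, ⟨colMat (blockIdx 0 h0), colMat (blockIdx 1 h1), colMat (blockIdx 0 h2),
      colMat_isometry (blockIdx_injective _ _), colMat_isometry (blockIdx_injective _ _),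
      colMat_orthogonal (blockIdx_ne _ _ (by omega)), colMat_isometry (blockIdx_injective _ _)⟩,
      hl, one_pos, by omega, fun h => absurd h (by omega)⟩
  · have hl : l ≤ (m - 1) / 2 := by omega
    have h0 : 0 + l ≤ m := by omega
    have h1 : l + (m - 1 - l) ≤ m := by omega
    have h2 : (m - 1) + 1 ≤ m := by omega
    exact ⟨m - 1 - l, ⟨colMat (blockIdx 0 h0), colMat (blockIdx l h1), colMat (blockIdx (m - 1) h2),
      colMat_isometry (blockIdx_injective _ _), colMat_isometry (blockIdx_injective _ _),
      colMat_orthogonal (blockIdx_ne _ _ (by omega)), colMat_isometry (blockIdx_injective _ _)⟩,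
      by omega, by omega, by omega, fun _ => ⟨colMat_orthogonal (blockIdx_ne _ _ (by omega)),
        colMat_orthogonal (blockIdx_ne _ _ (by omega))⟩⟩

/-! ### The minimax bounds -/

/-- Assouad's lemma for the trace regression model. -/
theorem minimaxProb_ge {m n r : ℕ} [NeZero (m ^ 2)] {σ : ℝ≥0} (hσ : 0 < σ)
    {E : Fin (m ^ 2) → Matrix (Fin m) (Fin m) ℂ} (hE : IsOrthonormalBasis E)
    {ι : Type*} [Fintype ι] [DecidableEq ι] [Nonempty ι] (ρ : (ι → Bool) → DensityMatrix m)
    (hr : ∀ ε, ρ ε ∈ lowRank r m)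
    (hclose : ∀ ε b, n * hsInner ((ρ ε).1 - (ρ (flipBit ε b)).1) ((ρ ε).1 - (ρ (flipBit ε b)).1) ≤
      4 * (σ : ℝ) ^ 2 * (m : ℝ) ^ 2)
    (𝒢 : Finset (ι → Bool)) (h𝒢 : (𝒢ᶜ.card : ℝ) ≤ 1 / 8 / 16 * 2 ^ Fintype.card ι)
    (bad : DensityMatrix m → DensityMatrix m → Prop)
    (hsep : ∀ ε ∈ 𝒢, ∀ ε' ∈ 𝒢, ∀ S, ¬bad S (ρ ε) → ¬bad S (ρ ε') →
      (hammingDist ε ε' : ℝ) ≤ 1 / 8 / 8 * Fintype.card ι) :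
    ENNReal.ofReal (1 / 64) ≤ minimaxProb n r E σ bad := by
  refine le_iInf fun est => ?_
  have : ∀ ε, IsProbabilityMeasure (sampleLaw n E σ (ρ ε)) := fun ε =>
    isProbabilityMeasure_sampleLaw hσ n E _
  obtain ⟨ε, -, hε⟩ := assouad_prob (fun ε => sampleLaw n E σ (ρ ε)) (α := 1 / 8) (by norm_num)
    (fun ε b A hA => errors_ge_of_close hσ n hE _ _ (hclose ε b) hA) 𝒢 h𝒢
    (fun ε => {d | bad (est.1 d) (ρ ε)}) fun ε h ε' h' d hd hd' => hsep ε h ε' h' _ hd hd'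
  refine le_trans ?_ (le_iSup₂_of_le (ρ ε) (hr ε) le_rfl)
  refine ENNReal.ofReal_le_of_le_toReal (le_trans (by norm_num) hε)

theorem noiseLevel_pos {m n : ℕ} {σ : ℝ≥0} (hm : 0 < m) (hn : 0 < n) (hσ : 0 < σ) :
    0 < noiseLevel m n σ := by
  have hσ' : (0 : ℝ) < σ := hσ
  unfold noiseLevel
  positivity

theorem mul_noiseLevel_sq {m n : ℕ} {σ : ℝ≥0} (hn : 0 < n) :
    n * noiseLevel m n σ ^ 2 = (σ : ℝ) ^ 2 * (m : ℝ) ^ 3 := by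
  have hn' : (0 : ℝ) < n := by exact_mod_cast hn
  have h : ((m : ℝ) ^ (3 / 2 : ℝ)) ^ 2 = (m : ℝ) ^ 3 := by
    rw [← Real.rpow_natCast, ← Real.rpow_mul (Nat.cast_nonneg m), ← Real.rpow_natCast]
    norm_num
  rw [noiseLevel, div_pow, mul_pow, Real.sq_sqrt hn'.le, h]
  field_simp

/-- The mass per direction, times the relative perturbation, in the least favourable family. It is
the noise level up to the factor `4`, which makes a single sign undetectable when `a ≥ m / 3`, cut
off at the total mass one. -/
def signal (τ : ℝ) : ℝ := min (τ / 4) 1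

theorem signal_pos {τ : ℝ} (hτ : 0 < τ) : 0 < signal τ := lt_min (by linarith) one_pos

theorem signal_le_one (τ : ℝ) : signal τ ≤ 1 := min_le_right _ _

theorem signal_sq_le {τ : ℝ} (hτ : 0 < τ) : 16 * signal τ ^ 2 ≤ τ ^ 2 := by
  have := pow_le_pow_left₀ (signal_pos hτ).le (min_le_left (τ / 4) 1) 2
  linarith

/-- The minimax rate is attained with `l` directions at the signal level if `l` is comparable to
`min (r, 1 / signal)`. -/
theorem rate_le {τ r l θ : ℝ} (hτ : 0 < τ) (hr : 1 ≤ r) (hl : 1 ≤ l) (h0 : 0 ≤ θ) (h1 : θ ≤ 1)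
    (h : min r (1 / signal τ) ≤ 4 * l) :
    min (min (τ * r ^ θ) (τ ^ (1 - θ))) 1 ≤ 16 * (signal τ * l ^ θ) := by
  have hlθ : 1 ≤ l ^ θ := Real.one_le_rpow hl h0
  rcases le_total 1 (τ / 4) with h4 | h4
  · refine (min_le_right _ _).trans ?_
    rw [signal, min_eq_right h4]
    linarith
  refine (min_le_left _ _).trans ?_
  rw [signal, min_eq_left h4] at h ⊢
  rcases min_le_iff.1 h with h5 | h5
  · refine (min_le_left _ _).trans ?_
    have h6 : r ^ θ ≤ 4 * l ^ θ := by
      refine (Real.rpow_le_rpow (by linarith) h5 h0).trans ?_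
      rw [Real.mul_rpow (by norm_num) (by linarith)]
      refine mul_le_mul_of_nonneg_right ?_ (by linarith)
      simpa using Real.rpow_le_rpow_of_exponent_le (by norm_num : (1 : ℝ) ≤ 4) h1
    nlinarith [mul_le_mul_of_nonneg_left h6 hτ.le]
  · refine (min_le_right _ _).trans ?_
    have h6 : 1 / τ ≤ l := by
      rw [div_div_eq_mul_div, div_le_iff₀ hτ] at h5
      rw [div_le_iff₀ hτ]
      linarith
    have h7 : τ ^ (1 - θ) = τ * (1 / τ) ^ θ := by
      rw [Real.rpow_sub hτ, Real.rpow_one, one_div, Real.inv_rpow hτ.le, div_eq_mul_inv]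
    have h8 := Real.rpow_le_rpow (by positivity) h6 h0
    rw [h7]
    nlinarith [mul_le_mul_of_nonneg_left h8 hτ.le]

/-- The number `l` of perturbed directions: below `r`, because the base state takes up one
dimension; at most half of the remaining dimensions of `ℂᵐ`; and of total mass at most one. -/
theorem exists_rank {τ : ℝ} (hτ : 0 < τ) {m r : ℕ} (hr : 2 ≤ r) (hrm : r ≤ m) :
    ∃ l : ℕ, 1 ≤ l ∧ l + 1 ≤ r ∧ l ≤ max 1 ((m - 1) / 2) ∧ l * signal τ ≤ 1 ∧
      min (r : ℝ) (1 / signal τ) ≤ 4 * l := by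
  have hs := signal_pos hτ
  have hs1 : 1 ≤ 1 / signal τ := (one_le_div hs).2 (signal_le_one τ)
  set x := 1 / signal τ with hx
  have hfl : 1 ≤ ⌊x⌋₊ := Nat.le_floor (by simpa using hs1)
  refine ⟨min (min (r - 1) (max 1 ((m - 1) / 2))) ⌊x⌋₊, by omega, by omega, by omega, ?_, ?_⟩
  · have h1 : ((min (min (r - 1) (max 1 ((m - 1) / 2))) ⌊x⌋₊ : ℕ) : ℝ) ≤ x :=
      (Nat.cast_le.2 (min_le_right _ _)).trans (Nat.floor_le (by linarith))
    have h2 := mul_le_mul_of_nonneg_right h1 hs.le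
    rwa [hx, one_div_mul_cancel hs.ne'] at h2
  · rcases le_total (min (r - 1) (max 1 ((m - 1) / 2))) ⌊x⌋₊ with h | h
    · rw [min_eq_left h]
      refine (min_le_left _ _).trans ?_
      have : r ≤ 4 * min (r - 1) (max 1 ((m - 1) / 2)) := by omega
      exact_mod_cast this
    · rw [min_eq_right h]
      refine (min_le_right _ _).trans ?_
      have h1 := Nat.lt_floor_add_one x
      have h2 : (1 : ℝ) ≤ ⌊x⌋₊ := by exact_mod_cast hfl
      linarith

/-- Neighbouring states of the cube are too close to be told apart from the sample. -/
theorem state_flipBit_le_noise {m n l a : ℕ} (hm : 0 < m) (hn : 0 < n) {σ : ℝ≥0} (hσ : 0 < σ)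
    (F : Frame m l a)
    (ha : 0 < a) (hma : m ≤ 3 * a) (w : Weights l) (hw : w.t * w.s = signal (noiseLevel m n σ))
    (ε : Fin a × Fin l → Bool) (b : Fin a × Fin l) :
    n * hsInner ((F.state w ha ε).1 - (F.state w ha (flipBit ε b)).1)
      ((F.state w ha ε).1 - (F.state w ha (flipBit ε b)).1) ≤ 4 * (σ : ℝ) ^ 2 * (m : ℝ) ^ 2 := by
  have h1 := F.state_flipBit_close w ha ε b
  rw [hw] at h1
  have h2 := signal_sq_le (noiseLevel_pos hm hn hσ)
  have h3 := mul_noiseLevel_sq (m := m) (σ := σ) hn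
  have ha' : (0 : ℝ) < a := by exact_mod_cast ha
  have hma' : (m : ℝ) ≤ 3 * a := by exact_mod_cast hma
  refine (mul_le_mul_of_nonneg_left h1 (Nat.cast_nonneg n)).trans ?_
  rw [← mul_div_assoc, div_le_iff₀ ha']
  have h4 := mul_le_mul_of_nonneg_left h2 (Nat.cast_nonneg (α := ℝ) n)
  have h5 : (0 : ℝ) ≤ (σ : ℝ) ^ 2 * (m : ℝ) ^ 2 := by positivity
  have h6 := mul_le_mul_of_nonneg_left hma' h5
  nlinarith [mul_nonneg h5 ha'.le]

/-- The bound in Schatten norm, for a family with `l` directions at the signal level. -/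
theorem minimaxProb_schatten_ge {m n r l a : ℕ} {σ : ℝ≥0} {q : ℝ≥0∞} (hq : 1 ≤ q) (hm : 2 ≤ m)
    (hn : 0 < n) (hr : 1 ≤ r) (hσ : 0 < σ) {E : Fin (m ^ 2) → Matrix (Fin m) (Fin m) ℂ}
    (hE : IsOrthonormalBasis E) (F : Frame m l a) (hl : 1 ≤ l) (hla : l ≤ a) (ha : 0 < a)
    (hma : m ≤ 3 * a) (w : Weights l) (hw : w.t * w.s = signal (noiseLevel m n σ))
    (hrank : ∀ ε, F.state w ha ε ∈ lowRank r m)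
    (hlr : min (r : ℝ) (1 / signal (noiseLevel m n σ)) ≤ 4 * l) :
    ENNReal.ofReal (1 / 64) ≤ minimaxProb n r E σ (fun est ρ =>
      (1 / 2 ^ 36 : ℝ) * min (min (noiseLevel m n σ * (r : ℝ) ^ (1 / q).toReal)
        (noiseLevel m n σ ^ (1 - (1 / q).toReal))) 1 ≤ schattenDist q est ρ) := by
  have : NeZero (m ^ 2) := ⟨by positivity⟩
  have : NeZero l := ⟨by omega⟩
  have : NeZero a := ⟨by omega⟩
  refine minimaxProb_ge hσ hE (F.state w ha) hrank
    (state_flipBit_le_noise (by omega) hn hσ F ha hma w hw) (goodSigns a l)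
    (card_goodSigns_compl_le hl hla) _ ?_
  intro ε hε ε' hε' S hS hS'
  by_contra! hd
  obtain ⟨U, hU, hUε⟩ := exists_contraction_signMat hl hla hε hε' hd
  have hlow := F.trace_test_state_sub w ha ε ε' hUε
  set ρ := F.state w ha ε
  set ρ' := F.state w ha ε'
  have hτ := noiseLevel_pos (m := m) (by omega) hn hσ
  set τ := noiseLevel m n σ
  have hq1 : (1 / q).toReal ≤ 1 := by
    rw [← ENNReal.toReal_one]
    exact ENNReal.toReal_mono ENNReal.one_ne_top (by simpa using hq)
  have hq0 : 0 ≤ (1 / q).toReal := ENNReal.toReal_nonneg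
  have hl' : (1 : ℝ) ≤ l := by exact_mod_cast hl
  have hrate := rate_le hτ (by exact_mod_cast hr : (1 : ℝ) ≤ r) hl' hq0 hq1 hlr
  set θ := (1 / q).toReal with hθ
  set M := min (min (τ * (r : ℝ) ^ θ) (τ ^ (1 - θ))) 1
  have h1 := norm_trace_test_mul_le hq (F.isContraction_V_mul hU) F.isContraction_P
    (S.2.1.isHermitian.sub ρ.2.1.isHermitian)
  have h2 := norm_trace_test_mul_le hq (F.isContraction_V_mul hU) F.isContraction_P
    (S.2.1.isHermitian.sub ρ'.2.1.isHermitian)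
  change ‖(F.test U * (S.1 - ρ.1)).trace‖ ≤ 2 * schattenDist q S ρ * _ at h1
  change ‖(F.test U * (S.1 - ρ'.1)).trace‖ ≤ 2 * schattenDist q S ρ' * _ at h2
  rw [← hθ, Fintype.card_fin] at h1 h2
  have hsplit : (F.test U * (ρ.1 - ρ'.1)).trace.re =
      (F.test U * (S.1 - ρ'.1)).trace.re - (F.test U * (S.1 - ρ.1)).trace.re := by
    rw [← Complex.sub_re, ← Matrix.trace_sub, ← Matrix.mul_sub, sub_sub_sub_cancel_left]
  have hup : (F.test U * (ρ.1 - ρ'.1)).trace.re ≤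
      2 * schattenDist q S ρ' * (2 * l : ℝ) ^ (1 - θ) +
        2 * schattenDist q S ρ * (2 * l : ℝ) ^ (1 - θ) := by
    rw [hsplit]
    have h3 := (Complex.re_le_norm _).trans h2
    have h4 := (neg_le_abs _).trans ((Complex.abs_re_le_norm _).trans h1)
    linarith
  have hpow : (2 * l : ℝ) ^ (1 - θ) ≤ 2 * (l : ℝ) ^ (1 - θ) := by
    rw [Real.mul_rpow (by norm_num) (by linarith)]
    refine mul_le_mul_of_nonneg_right ?_ (by positivity)
    simpa using Real.rpow_le_rpow_of_exponent_le (by norm_num : (1 : ℝ) ≤ 2)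
      (by linarith : 1 - θ ≤ 1)
  have hll : (l : ℝ) ^ θ * (l : ℝ) ^ (1 - θ) = l := by
    rw [← Real.rpow_add (by linarith)]
    simp
  have hs := signal_pos hτ
  rw [not_le] at hS hS'
  have hpow0 : (0 : ℝ) ≤ (2 * l : ℝ) ^ (1 - θ) := by positivity
  have hM : 4 * (1 / 2 ^ 36 * M) * (2 * l : ℝ) ^ (1 - θ) ≤
      4 * (1 / 2 ^ 36 * (16 * (signal τ * (l : ℝ) ^ θ))) * (2 * (l : ℝ) ^ (1 - θ)) :=
    mul_le_mul (by linarith) hpow hpow0 (by positivity)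
  have hM' : 4 * (1 / 2 ^ 36 * (16 * (signal τ * (l : ℝ) ^ θ))) * (2 * (l : ℝ) ^ (1 - θ)) =
      1 / 2 ^ 29 * (signal τ * l) := by
    linear_combination 1 / 2 ^ 29 * signal τ * hll
  have h5 := mul_le_mul_of_nonneg_right hS.le hpow0
  have h6 := mul_le_mul_of_nonneg_right hS'.le hpow0
  rw [hw] at hlow
  have h7 : 0 < signal τ * l := by positivity
  linarith

/-- The bound for losses that dominate Hellinger closeness, for a family with `l` directions at
the signal level. -/
theorem minimaxProb_isNear_ge {m n r l a : ℕ} {σ : ℝ≥0} (hm : 2 ≤ m)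
    (hn : 0 < n) (hr : 1 ≤ r) (hσ : 0 < σ) {E : Fin (m ^ 2) → Matrix (Fin m) (Fin m) ℂ}
    (hE : IsOrthonormalBasis E) (F : Frame m l a) (hl : 1 ≤ l) (hla : l ≤ a) (ha : 0 < a)
    (hma : m ≤ 3 * a) (hPo : F.Pᴴ * F.o = 0) (hVo : F.Vᴴ * F.o = 0) (w : Weights l)
    (hws : w.s = 1) (hw : w.t = signal (noiseLevel m n σ))
    (hrank : ∀ ε, F.state w ha ε ∈ lowRank r m)
    (hlr : min (r : ℝ) (1 / signal (noiseLevel m n σ)) ≤ 4 * l)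
    (bad : DensityMatrix m → DensityMatrix m → Prop)
    (hbad : ∀ S ρ, ¬bad S ρ → IsNear ((1 / 2 ^ 36 : ℝ) * min (noiseLevel m n σ * (r : ℝ)) 1) S ρ) :
    ENNReal.ofReal (1 / 64) ≤ minimaxProb n r E σ bad := by
  have : NeZero (m ^ 2) := ⟨by positivity⟩
  have : NeZero l := ⟨by omega⟩
  have : NeZero a := ⟨by omega⟩
  have hw' : w.t * w.s = signal (noiseLevel m n σ) := by rw [hws, mul_one, hw]
  refine minimaxProb_ge hσ hE (F.state w ha) hrank
    (state_flipBit_le_noise (by omega) hn hσ F ha hma w hw') (goodSigns a l)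
    (card_goodSigns_compl_le hl hla) _ ?_
  intro ε hε ε' hε' S hS hS'
  by_contra! hd
  obtain ⟨U, hU, hUε⟩ := exists_contraction_signMat hl hla hε hε' hd
  have hlow := F.trace_test_state_sub w ha ε ε' hUε
  have hτ := noiseLevel_pos (m := m) (by omega) hn hσ
  have hs := signal_pos hτ
  have hl' : (1 : ℝ) ≤ l := by exact_mod_cast hl
  have hrate := rate_le hτ (by exact_mod_cast hr : (1 : ℝ) ≤ r) hl' zero_le_one le_rfl hlr
  rw [sub_self, Real.rpow_zero, Real.rpow_one, Real.rpow_one, min_assoc, min_self] at hrate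
  set τ := noiseLevel m n σ
  set κ := l * signal τ with hκ
  have hκ0 : 0 < κ := by positivity
  have hmass : ∀ δ, (F.test U * (F.state w ha δ).1 * F.test U).trace.re ≤ 4 * κ := fun δ => by
    rw [hκ, ← hw]
    exact F.trace_test_state_test_le w ha hPo hVo δ hU
  have hup := trace_test_le_of_isNear (κ := κ) hκ0.le (F.test_isHermitian U)
    (fun X => F.frobSq_test_mul_le hU X)
    (hmass ε) (hmass ε') (hbad _ _ hS) (hbad _ _ hS')
  set h := 1 / 2 ^ 36 * min (τ * (r : ℝ)) 1
  have hh : h ≤ (1 / 2 ^ 16) ^ 2 * κ := by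
    have := mul_le_mul_of_nonneg_left hrate (by norm_num : (0 : ℝ) ≤ 1 / 2 ^ 36)
    refine this.trans (le_of_eq ?_)
    rw [hκ]
    ring
  have hsq : √h ≤ 1 / 2 ^ 16 * √κ := by
    rw [Real.sqrt_le_left (by positivity), mul_pow, Real.sq_sqrt hκ0.le]
    exact hh
  have h3 := mul_le_mul_of_nonneg_right hsq (Real.sqrt_nonneg κ)
  rw [mul_assoc, Real.mul_self_sqrt hκ0.le] at h3
  rw [hw', mul_comm (signal τ), ← hκ] at hlow
  linarith

/-- A diagonal qubit state. -/
def qubitState (κ : ℝ) (h0 : 0 ≤ κ) (h1 : κ ≤ 1) : DensityMatrix 2 :=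
  ⟨Matrix.diagonal ![((1 - κ : ℝ) : ℂ), (κ : ℂ)], by
    refine ⟨Matrix.PosSemidef.diagonal fun i => ?_, ?_⟩
    · fin_cases i
      · exact Complex.zero_le_real.2 (by linarith)
      · exact Complex.zero_le_real.2 h0
    · simp [Matrix.trace_diagonal, Fin.sum_univ_two]⟩

/-- For qubits, where no base vector orthogonal to the frame exists, two diagonal states with small
eigenvalues in the ratio `1 : 2` suffice. -/
theorem minimaxProb_isNear_qubit_ge {n : ℕ} {σ : ℝ≥0} (hn : 0 < n) (hσ : 0 < σ)
    {E : Fin (2 ^ 2) → Matrix (Fin 2) (Fin 2) ℂ} (hE : IsOrthonormalBasis E)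
    (bad : DensityMatrix 2 → DensityMatrix 2 → Prop)
    (hbad : ∀ S ρ, ¬bad S ρ →
      IsNear ((1 / 2 ^ 36 : ℝ) * min (noiseLevel 2 n σ * ((2 : ℕ) : ℝ)) 1) S ρ) :
    ENNReal.ofReal (1 / 64) ≤ minimaxProb n 2 E σ bad := by
  have hτ := noiseLevel_pos (m := 2) (by norm_num) hn hσ
  have hs := signal_pos hτ
  have hs1 := signal_le_one (noiseLevel 2 n σ)
  have hsq := signal_sq_le hτ
  have hnoise := mul_noiseLevel_sq (m := 2) (σ := σ) hn
  have hrate : min (noiseLevel 2 n σ * ((2 : ℕ) : ℝ)) 1 ≤ 16 * signal (noiseLevel 2 n σ) := by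
    rw [signal, mul_min_of_nonneg _ _ (by norm_num)]
    refine min_le_min ?_ (by norm_num)
    push_cast
    linarith
  set τ := noiseLevel 2 n σ
  set κ := signal τ with hκ
  have hmass : ∀ δ : Bool, 0 ≤ κ * (3 + bitSign δ) / 4 ∧ κ * (3 + bitSign δ) / 4 ≤ κ := fun δ => by
    have hδ : bitSign δ = 1 ∨ bitSign δ = -1 := by cases δ <;> simp [bitSign]
    rcases hδ with hδ | hδ <;> rw [hδ] <;> constructor <;> linarith
  set ρ : (Fin 1 → Bool) → DensityMatrix 2 := fun ε => qubitState (κ * (3 + bitSign (ε 0)) / 4)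
    (hmass _).1 ((hmass _).2.trans hs1) with hρ
  have hflip : ∀ ε : Fin 1 → Bool, ∀ b, bitSign (flipBit ε b 0) = -bitSign (ε 0) := fun ε b => by
    rw [Subsingleton.elim b 0, flipBit_same, bitSign_not]
  refine minimaxProb_ge hσ hE ρ (fun ε => ?_) (fun ε b => ?_) Finset.univ (by simp) bad ?_
  · exact (Matrix.rank_le_card_width _).trans (by simp)
  · have h1 : hsInner ((ρ ε).1 - (ρ (flipBit ε b)).1) ((ρ ε).1 - (ρ (flipBit ε b)).1) =
        κ ^ 2 / 2 * (bitSign (ε 0) * bitSign (ε 0)) := by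
      simp only [hρ, qubitState, hflip, hsInner, Matrix.diagonal_sub, Matrix.diagonal_mul_diagonal,
        Matrix.trace_diagonal, Fin.sum_univ_two, Matrix.cons_val_zero, Matrix.cons_val_one,
        ← Complex.ofReal_sub, ← Complex.ofReal_mul, ← Complex.ofReal_add, Complex.ofReal_re]
      ring
    rw [h1, bitSign_mul_self]
    have hn' := mul_le_mul_of_nonneg_left hsq (Nat.cast_nonneg (α := ℝ) n)
    push_cast at hnoise ⊢
    nlinarith [sq_nonneg (σ : ℝ)]
  · intro ε _ ε' _ S hS hS'
    by_contra! hd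
    -- the observable is the projection onto the second basis vector
    set W : Matrix (Fin 2) (Fin 2) ℂ := Matrix.diagonal ![0, 1] with hW
    have hWh : W.IsHermitian := by
      rw [Matrix.IsHermitian, hW, Matrix.diagonal_conjTranspose]
      congr 1
      ext i
      fin_cases i <;> simp
    have hWc : ∀ X : Matrix (Fin 2) (Fin 2) ℂ, frobSq (W * X) ≤ 4 * frobSq X := fun X => by
      simp only [hW, frobSq, Fin.sum_univ_two, Matrix.diagonal_mul, Matrix.cons_val_zero,
        Matrix.cons_val_one, zero_mul, one_mul, norm_zero]
      nlinarith [sq_nonneg ‖X 0 0‖, sq_nonneg ‖X 0 1‖, sq_nonneg ‖X 1 0‖, sq_nonneg ‖X 1 1‖]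
    have hWm : ∀ δ, (W * (ρ δ).1 * W).trace.re ≤ 4 * κ := fun δ => by
      have : (W * (ρ δ).1 * W).trace.re = κ * (3 + bitSign (δ 0)) / 4 := by
        simp only [hW, hρ, qubitState, Matrix.diagonal_mul_diagonal, Matrix.trace_diagonal,
          Fin.sum_univ_two, Matrix.cons_val_zero, Matrix.cons_val_one, zero_mul, one_mul, mul_one,
          zero_add, mul_zero, Complex.ofReal_re]
      rw [this]
      linarith [(hmass (δ 0)).2]
    have hWs : ∀ δ δ', (W * ((ρ δ).1 - (ρ δ').1)).trace.re =
        κ * (bitSign (δ 0) - bitSign (δ' 0)) / 4 := fun δ δ' => by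
      simp only [hW, hρ, qubitState, Matrix.diagonal_sub, Matrix.diagonal_mul_diagonal,
        Matrix.trace_diagonal, Fin.sum_univ_two, Matrix.cons_val_zero, Matrix.cons_val_one,
        zero_mul, one_mul, zero_add, ← Complex.ofReal_sub, Complex.ofReal_re]
      ring
    have hup := trace_test_le_of_isNear hs.le hWh hWc (hWm ε) (hWm ε') (hbad _ _ hS) (hbad _ _ hS')
    have hup' := trace_test_le_of_isNear hs.le hWh hWc (hWm ε') (hWm ε) (hbad _ _ hS')
      (hbad _ _ hS)
    rw [hWs] at hup hup'
    have hne : ε 0 ≠ ε' 0 := fun he => by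
      have : ε = ε' := funext fun i => by rw [Subsingleton.elim i 0, he]
      rw [this, hammingDist_self] at hd
      norm_num at hd
    set h := 1 / 2 ^ 36 * min (τ * ((2 : ℕ) : ℝ)) 1
    have hh : h ≤ (1 / 2 ^ 16) ^ 2 * κ := by
      have := mul_le_mul_of_nonneg_left hrate (by norm_num : (0 : ℝ) ≤ 1 / 2 ^ 36)
      exact this.trans (le_of_eq (by ring))
    have hsq' : √h ≤ 1 / 2 ^ 16 * √κ := by
      rw [Real.sqrt_le_left (by positivity), mul_pow, Real.sq_sqrt hs.le]
      exact hh
    have h3 := mul_le_mul_of_nonneg_right hsq' (Real.sqrt_nonneg κ)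
    rw [mul_assoc, Real.mul_self_sqrt hs.le] at h3
    rcases h4 : ε 0 <;> rcases h5 : ε' 0 <;> rw [h4, h5] at hup hup'
    · exact hne (h4.trans h5.symm)
    · norm_num [bitSign] at hup'
      linarith
    · norm_num [bitSign] at hup
      linarith
    · exact hne (h4.trans h5.symm)

/-- The minimax lower bound in Schatten norm. -/
theorem minimaxProb_schatten {m n r : ℕ} {σ : ℝ≥0} {q : ℝ≥0∞} (hq : 1 ≤ q) (hm : 2 ≤ m)
    (hn : 0 < n) (hr : 1 ≤ r) (hrm : r ≤ m) (hσ : 0 < σ)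
    {E : Fin (m ^ 2) → Matrix (Fin m) (Fin m) ℂ} (hE : IsOrthonormalBasis E) :
    ENNReal.ofReal (1 / 64) ≤ minimaxProb n r E σ (fun est ρ =>
      (1 / 2 ^ 36 : ℝ) * min (min (noiseLevel m n σ * (r : ℝ) ^ (1 / q).toReal)
        (noiseLevel m n σ ^ (1 - (1 / q).toReal))) 1 ≤ schattenDist q est ρ) := by
  have hτ := noiseLevel_pos (m := m) (by omega) hn hσ
  have hs := signal_pos hτ
  have hs1 := signal_le_one (noiseLevel m n σ)
  rcases hr.eq_or_lt with rfl | hr2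
  · -- rank one: pure states, close to a fixed one
    obtain ⟨a, F, hla, ha, hma, -⟩ := exists_frame hm (le_max_left 1 ((m - 1) / 2))
    let w : Weights 1 := ⟨signal (noiseLevel m n σ), 1, 0, hs.le, hs1, zero_le_one, le_rfl,
      by simp⟩
    refine minimaxProb_schatten_ge hq hm hn le_rfl hσ hE F le_rfl hla ha hma w (one_mul _)
      (fun ε => F.state_rank_le_of_base_eq_zero w rfl ha ε) ?_
    exact (min_le_left _ _).trans (by norm_num)
  · obtain ⟨l, hl, hlr, hlm, hls, hmin⟩ := exists_rank hτ hr2 hrm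
    obtain ⟨a, F, hla, ha, hma, -⟩ := exists_frame hm hlm
    let w : Weights l := ⟨1, signal (noiseLevel m n σ), 1 - l * signal (noiseLevel m n σ),
      zero_le_one, le_rfl, hs.le, by linarith, by ring⟩
    exact minimaxProb_schatten_ge hq hm hn hr hσ hE F hl hla ha hma w (mul_one _)
      (fun ε => (F.state_rank_le w ha ε).trans hlr) hmin

/-- The minimax lower bound for every loss that dominates Hellinger closeness. -/
theorem minimaxProb_isNear {m n r : ℕ} {σ : ℝ≥0} (hm : 2 ≤ m)
    (hn : 0 < n) (hr : 2 ≤ r) (hrm : r ≤ m) (hσ : 0 < σ)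
    {E : Fin (m ^ 2) → Matrix (Fin m) (Fin m) ℂ} (hE : IsOrthonormalBasis E)
    (bad : DensityMatrix m → DensityMatrix m → Prop)
    (hbad : ∀ S ρ, ¬bad S ρ → IsNear ((1 / 2 ^ 36 : ℝ) * min (noiseLevel m n σ * (r : ℝ)) 1) S ρ) :
    ENNReal.ofReal (1 / 64) ≤ minimaxProb n r E σ bad := by
  rcases hm.eq_or_lt with rfl | hm3
  · obtain rfl : r = 2 := le_antisymm hrm hr
    exact minimaxProb_isNear_qubit_ge hn hσ hE bad hbad
  · have hτ := noiseLevel_pos (m := m) (by omega) hn hσ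
    have hs := signal_pos hτ
    obtain ⟨l, hl, hlr, hlm, hls, hmin⟩ := exists_rank hτ hr hrm
    obtain ⟨a, F, hla, ha, hma, ho⟩ := exists_frame hm hlm
    let w : Weights l := ⟨1, signal (noiseLevel m n σ), 1 - l * signal (noiseLevel m n σ),
      zero_le_one, le_rfl, hs.le, by linarith, by ring⟩
    exact minimaxProb_isNear_ge hm hn (by omega) hσ hE F hl hla ha hma (ho hm3).1 (ho hm3).2 w rfl
      rfl (fun ε => (F.state_rank_le w ha ε).trans hlr) hmin bad hbad

end TraceRegression
end

open TraceRegression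
theorem mainTheorem3 (q : ℝ≥0∞) (hq : 1 ≤ q) :
    ∃ c c' : ℝ, 0 < c ∧ 0 < c' ∧
      ∀ (m n r : ℕ) (σ : ℝ≥0) (E : Fin (m ^ 2) → Matrix (Fin m) (Fin m) ℂ),
        2 ≤ m → 1 ≤ n → 1 ≤ r → r ≤ m → 0 < σ → TraceRegression.IsOrthonormalBasis E →
          ENNReal.ofReal c' ≤ minimaxProb n r E σ (fun est ρ =>
            c * min (min (noiseLevel m n σ * (r : ℝ) ^ (1 / q).toReal)
              (noiseLevel m n σ ^ (1 - (1 / q).toReal))) 1 ≤ schattenDist q est ρ) ∧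
          (2 ≤ r →
            ENNReal.ofReal c' ≤ minimaxProb n r E σ (fun est ρ =>
              c * min (noiseLevel m n σ * (r : ℝ)) 1 ≤ buresSq est ρ) ∧
            ENNReal.ofReal c' ≤ minimaxProb n r E σ (fun est ρ =>
              ((c * min (noiseLevel m n σ * (r : ℝ)) 1 : ℝ) : EReal) ≤ relEntropy ρ est)) := by
  refine ⟨1 / 2 ^ 36, 1 / 64, by norm_num, by norm_num, ?_⟩
  intro m n r σ E hm hn hr hrm hσ hE
  refine ⟨minimaxProb_schatten hq hm hn hr hrm hσ hE, fun hr2 => ⟨?_, ?_⟩⟩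
  · exact minimaxProb_isNear hm hn hr2 hrm hσ hE _ fun S ρ h => isNear_of_buresSq_lt (not_le.1 h)
  · exact minimaxProb_isNear hm hn hr2 hrm hσ hE _ fun S ρ h =>
      isNear_of_relEntropy_lt (not_le.1 h)
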